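/- Let $d\in\{1,2,3\}$ and let $\mathbb{R}^d=\bigcup_{j=0}^{J}\overline{\Omega}_j$, where the $\Omega_j$ are pairwise disjoint Lipschitz open sets (locally the region strictly below the graph of a Lipschitz function) and $\Omega_j$ is bounded for $j\neq 0$. Let $\mu:\mathbb{R}^d\to(0,\infty)$ and $\kappa:\mathbb{R}^d\to\mathbb{C}$ be measurable, with $\mu,\mu^{-1},\kappa$ bounded, $\Re\kappa\ge 0$, $\Im\kappa\ge 0$, $\kappa\ne 0$ everywhere, and $\kappa(x)=\kappa_0$, $\mu(x)=1$ for $|x|>\rho_0$, where $\kappa_0,\rho_0>0$ are constants. Assume that $\mu_j:=\mu|_{\Omega_j}$ is Lipschitz continuous for every $j$, and denote its continuous extension to $\partial\Omega_j$ by $\mu_j$ as well. Let $H^{1/2}(\partial\Omega_j)$ be the space of Dirichlet traces $v|_{\partial\Omega_j}$ of functions $v\in H^1(\Omega_j)$, normed by $\|t\|=\inf\{\|v\|_{H^1(\Omega_j)}: v|_{\partial\Omega_j}=t\}$, and let $H^{-1/2}(\partial\Omega_j)$ be its dual, with bilinear duality pairing $\langle p,v\rangle_{\partial\Omega_j}=\langle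 v,p\rangle_{\partial\Omega_j}$ and conjugation $\langle\overline p,v\rangle_{\partial\Omega_j}=\overline{\langle p,\overline v\rangle_{\partial\Omega_j}}$. For $(u,p),(v,q)\in H^{1/2}(\partial\Omega_j)\times H^{-1/2}(\partial\Omega_j)$ put $$[(u,p),(v,q)]_{\partial\Omega_j}:=\langle u,q\rangle_{\partial\Omega_j}-\langle v,p\rangle_{\partial\Omega_j}.$$ For $\varphi$ in $H^1_{\mathrm{loc}}(\Delta,\overline\Omega_j)$ (that is, $\varphi,\nabla\varphi,\Delta\varphi$ are square integrable on bounded parts of $\Omega_j$), the Neumann trace $\partial_{n_j}\varphi\in H^{-1/2}(\partial\Omega_j)$ is the outward normal derivative, in the usual weak sense: $\langle\partial_{n_j}\varphi,w|_{\partial\Omega_j}\rangle_{\partial\Omega_j}=\int_{\Omega_j}\nabla\varphi\cdot\nabla w+(\Delta\varphi)\,w\,dx$ for all $w\in H^1(\Omega_j)$ with bounded support. Let $$\mathscr{C}^+(\Omega_j):=\bigl\{(\varphi|_{\partial\Omega_j},\ \mu_j\,\partial_{n_j}\varphi)\ :\ \varphi\in H^1_{\mathrm{loc}}(\Delta,\overline\Omega_j),\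 \operatorname{div}(\mu\nabla\varphi)+\kappa^2\varphi=0\text{ in }\Omega_j,\ \varphi\ \kappa_0\text{-outgoing if }j=0\bigr\},$$ where $\kappa_0$-outgoing means $\lim_{\rho\to\infty}\int_{|x|=\rho}|\partial_\rho\varphi-i\kappa_0\varphi|^2\,d\sigma_\rho=0$, and let $\mathscr{C}^+(\Gamma):=\mathscr{C}^+(\Omega_0)\times\dots\times\mathscr{C}^+(\Omega_J)$. Then for every $j=0,\dots,J$ and every $\mathbf u\in\mathscr{C}^+(\Omega_j)$, the number $i[\mathbf u,\overline{\mathbf u}]_{\partial\Omega_j}$ is real and $$i[\mathbf u,\overline{\mathbf u}]_{\partial\Omega_j}\le 0.$$ Consequently, for every $\mathbf u=(\mathbf u_j)_{j=0}^{J}\in\mathscr{C}^+(\Gamma)$, the number $i\sum_{j=0}^{J}[\mathbf u_j,\overline{\mathbf u}_j]_{\partial\Omega_j}$ is real and $\le 0$. -/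

import Mathlib

open MeasureTheory Filter Topology Set
open scoped ENNReal ContDiff ComplexOrder

noncomputable section

namespace Helmholtz

/-- The Euclidean space `ℝ^d`. -/
abbrev Space (d : ℕ) := EuclideanSpace ℝ (Fin d)

/-- The space `ℂ^d`, in which gradients of complex valued functions take their values. -/
abbrev CVec (d : ℕ) := EuclideanSpace ℂ (Fin d)

variable {d : ℕ}

/-! ### Geometry -/

/-- An open set which, near each of its boundary points, is the part of the space lying strictly
below the graph of a Lipschitz function. The direction "up" is the unit vector `e`; the Lipschitz
function `h` depends only on the component orthogonal to `e`. -/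
def IsLipschitzOpen (Ω : Set (Space d)) : Prop :=
  IsOpen Ω ∧ ∀ x ∈ frontier Ω, ∃ (e : Space d) (h : Space d → ℝ) (K : NNReal) (r : ℝ),
    ‖e‖ = 1 ∧ LipschitzWith K h ∧ (∀ (y : Space d) (s : ℝ), h (y + s • e) = h y) ∧ 0 < r ∧
      ∀ y ∈ Metric.ball x r, (y ∈ Ω ↔ inner ℝ e y < h y)

/-- Non-overlapping partition of `ℝ^d` into Lipschitz open sets `Ω_0, …, Ω_J`, all of them bounded
except possibly `Ω_0`. -/
structure IsSubdomainPartition {J : ℕ} (Ω : Fin (J + 1) → Set (Space d)) : Prop where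
  lipschitz : ∀ j, IsLipschitzOpen (Ω j)
  disjoint : ∀ j k, j ≠ k → Disjoint (Ω j) (Ω k)
  covers : ⋃ j, closure (Ω j) = univ
  bounded : ∀ j, j ≠ 0 → Bornology.IsBounded (Ω j)

/-- Assumptions on the coefficients `μ : ℝ^d → (0, ∞)` and `κ : ℝ^d → ℂ`. -/
structure IsAdmissibleMedium (μ : Space d → ℝ) (κ : Space d → ℂ) (κ₀ ρ₀ : ℝ) : Prop where
  measurable_mu : Measurable μ
  measurable_kappa : Measurable κ
  kappa₀_pos : 0 < κ₀
  rho₀_pos : 0 < ρ₀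
  mu_pos : ∀ x, 0 < μ x
  bounded : ∃ C : ℝ, ∀ x, |μ x| + |(μ x)⁻¹| + ‖κ x‖ ≤ C
  kappa_re : ∀ x, 0 ≤ (κ x).re
  kappa_im : ∀ x, 0 ≤ (κ x).im
  kappa_ne : ∀ x, κ x ≠ 0
  kappa_far : ∀ x, ρ₀ < ‖x‖ → κ x = κ₀
  mu_far : ∀ x, ρ₀ < ‖x‖ → μ x = 1

/-! ### Volume based function spaces -/

/-- Bilinear (not sesquilinear) dot product on `ℂ^d`. -/
def dot (a b : CVec d) : ℂ := ∑ i, a i * b i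

/-- Complex conjugate of a vector of `ℂ^d`. -/
def conjVec (a : CVec d) : CVec d := WithLp.toLp 2 fun i => star (a i)

/-- Classical gradient of a differentiable complex valued function. -/
def grad (ψ : Space d → ℂ) (x : Space d) : CVec d :=
  WithLp.toLp 2 fun i => fderiv ℝ ψ x (EuclideanSpace.single i 1)

/-- Smooth complex valued functions with compact support contained in `Ω`. -/
def IsTest (Ω : Set (Space d)) (ψ : Space d → ℂ) : Prop :=
  ContDiff ℝ ∞ ψ ∧ HasCompactSupport ψ ∧ tsupport ψ ⊆ Ω

/-- `g` is the weak gradient of `φ` in `Ω` (always used together with local integrability). -/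
def IsWeakGrad (Ω : Set (Space d)) (φ : Space d → ℂ) (g : Space d → CVec d) : Prop :=
  ∀ ψ, IsTest Ω ψ → ∀ i, ∫ x in Ω, φ x * grad ψ x i = - ∫ x in Ω, g x i * ψ x

/-- `f` is the weak divergence of `F` in `Ω` (always used together with local integrability). -/
def IsWeakDiv (Ω : Set (Space d)) (F : Space d → CVec d) (f : Space d → ℂ) : Prop :=
  ∀ ψ, IsTest Ω ψ → ∫ x in Ω, dot (F x) (grad ψ x) = - ∫ x in Ω, f x * ψ x

/-- `φ ∈ H¹(Ω)`, with weak gradient `g`. -/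
structure MemH1 (Ω : Set (Space d)) (φ : Space d → ℂ) (g : Space d → CVec d) : Prop where
  memLp : MemLp φ 2 (volume.restrict Ω)
  memLp_grad : MemLp g 2 (volume.restrict Ω)
  weakGrad : IsWeakGrad Ω φ g

/-- The `H¹(Ω)` norm of `φ` with weak gradient `g`. -/
def h1Norm (Ω : Set (Space d)) (φ : Space d → ℂ) (g : Space d → CVec d) : ℝ :=
  √((∫ x in Ω, ‖g x‖ ^ 2) + ∫ x in Ω, ‖φ x‖ ^ 2)

/-- `f` is square integrable on every bounded part of `Ω` (up to the boundary of `Ω`). -/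
def MemL2Loc {F : Type*} [NormedAddCommGroup F] (Ω : Set (Space d)) (f : Space d → F) : Prop :=
  ∀ R : ℝ, MemLp f 2 (volume.restrict (Ω ∩ Metric.ball 0 R))

/-- `φ ∈ H¹_loc(closure Ω)`, with weak gradient `g`: the function belongs to `H¹` on bounded parts
of `Ω`, up to the boundary of `Ω`. -/
structure MemH1Loc (Ω : Set (Space d)) (φ : Space d → ℂ) (g : Space d → CVec d) : Prop where
  memL2Loc : MemL2Loc Ω φ
  memL2Loc_grad : MemL2Loc Ω g
  weakGrad : IsWeakGrad Ω φ g

/-- `φ ∈ H¹_loc(Δ, closure Ω)`, with weak gradient `g` and weak Laplacian `L`. -/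
structure MemH1LapLoc (Ω : Set (Space d)) (φ : Space d → ℂ) (g : Space d → CVec d)
    (L : Space d → ℂ) : Prop where
  memH1Loc : MemH1Loc Ω φ g
  memL2Loc_lap : MemL2Loc Ω L
  weakDiv : IsWeakDiv Ω g L

/-! ### Trace spaces -/

/-- Surface measure on the boundary of `Ω`: the `(d-1)`-dimensional Hausdorff measure (it is used
only through its null sets and the topology of `L²(∂Ω)`, so its normalisation is irrelevant). -/
def bdry (Ω : Set (Space d)) : Measure (Space d) :=
  (Measure.hausdorffMeasure ((d : ℝ) - 1)).restrict (frontier Ω)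

/-- `t ∈ L²(∂Ω)` is the Dirichlet trace of `φ ∈ H¹_loc(closure Ω)` (with weak gradient `g`): this is
the extension by continuity of the restriction to `∂Ω` of functions that are smooth up to the
boundary. -/
def IsDirichletTrace (Ω : Set (Space d)) (φ : Space d → ℂ) (g : Space d → CVec d)
    (t : Lp ℂ 2 (bdry Ω)) : Prop :=
  ∃ w : ℕ → Space d → ℂ, (∀ n, ContDiff ℝ ∞ (w n)) ∧
    (∀ R : ℝ, Tendsto (fun n => eLpNorm (fun x => w n x - φ x) 2
      (volume.restrict (Ω ∩ Metric.ball 0 R))) atTop (𝓝 0)) ∧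
    (∀ R : ℝ, Tendsto (fun n => eLpNorm (fun x => grad (w n) x - g x) 2
      (volume.restrict (Ω ∩ Metric.ball 0 R))) atTop (𝓝 0)) ∧
    Tendsto (fun n => eLpNorm (fun x => w n x - t x) 2 (bdry Ω)) atTop (𝓝 0)

section TraceLemmas

variable {Ω : Set (Space d)} {φ φ' : Space d → ℂ} {g g' : Space d → CVec d}

lemma grad_add {ψ ψ' : Space d → ℂ} (h : ContDiff ℝ ∞ ψ) (h' : ContDiff ℝ ∞ ψ') (x : Space d) :
    grad (fun y => ψ y + ψ' y) x = grad ψ x + grad ψ' x := by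
  ext i
  have e : fderiv ℝ (fun y => ψ y + ψ' y) x = fderiv ℝ ψ x + fderiv ℝ ψ' x :=
    fderiv_add (h.differentiable (by simp) x) (h'.differentiable (by simp) x)
  simp [grad, e]

lemma grad_const_mul {ψ : Space d → ℂ} (h : ContDiff ℝ ∞ ψ) (c : ℂ) (x : Space d) :
    grad (fun y => c * ψ y) x = c • grad ψ x := by
  ext i
  have e : fderiv ℝ (fun y => c * ψ y) x = c • fderiv ℝ ψ x :=
    fderiv_const_mul (h.differentiable (by simp) x) c
  simp [grad, e]

lemma grad_conj (ψ : Space d → ℂ) (x : Space d) :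
    grad (fun y => star (ψ y)) x = conjVec (grad ψ x) := by
  ext i
  have e : fderiv ℝ (fun y => star (ψ y)) x = ((starL' ℝ : ℂ ≃L[ℝ] ℂ) : ℂ →L[ℝ] ℂ) ∘L fderiv ℝ ψ x :=
    fderiv_star
  change fderiv ℝ (fun y => star (ψ y)) x _ = star _
  rw [e]
  rfl

lemma IsTest.memLp {ψ : Space d → ℂ} (h : IsTest Ω ψ) : MemLp ψ 2 (volume.restrict Ω) :=
  h.1.continuous.memLp_of_hasCompactSupport h.2.1

lemma IsTest.memLp_grad {ψ : Space d → ℂ} (h : IsTest Ω ψ) (i : Fin d) :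
    MemLp (fun x => grad ψ x i) 2 (volume.restrict Ω) := by
  have hc : Continuous (fun x => fderiv ℝ ψ x (EuclideanSpace.single i 1)) :=
    (h.1.continuous_fderiv (by simp)).clm_apply continuous_const
  exact hc.memLp_of_hasCompactSupport (h.2.1.fderiv_apply (𝕜 := ℝ) _)

lemma IsTest.conj {ψ : Space d → ℂ} (h : IsTest Ω ψ) : IsTest Ω (fun x => star (ψ x)) := by
  have hs : Function.support (fun x => star (ψ x)) = Function.support ψ := by
    ext x; simp
  refine ⟨(starL' ℝ : ℂ ≃L[ℝ] ℂ).contDiff.comp h.1, ?_, ?_⟩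
  · have := h.2.1
    rwa [HasCompactSupport, tsupport, hs]
  · have := h.2.2
    rwa [tsupport, hs]

lemma memLp_coord {ν : Measure (Space d)} (h : MemLp g 2 ν) (i : Fin d) :
    MemLp (fun x => g x i) 2 ν := by
  refine h.mono ?_ (Eventually.of_forall fun x => PiLp.norm_apply_le (g x) i)
  exact (EuclideanSpace.proj (𝕜 := ℂ) i).continuous.comp_aestronglyMeasurable h.1

lemma MemH1.zero : MemH1 Ω (fun _ => 0) (fun _ => 0) where
  memLp := MemLp.zero'
  memLp_grad := MemLp.zero'
  weakGrad := by intro ψ _ i; simp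

lemma MemH1.add (h : MemH1 Ω φ g) (h' : MemH1 Ω φ' g') :
    MemH1 Ω (fun x => φ x + φ' x) (fun x => g x + g' x) where
  memLp := h.memLp.add h'.memLp
  memLp_grad := h.memLp_grad.add h'.memLp_grad
  weakGrad := by
    intro ψ hψ i
    have h1 := h.weakGrad ψ hψ i
    have h2 := h'.weakGrad ψ hψ i
    simp only [PiLp.add_apply, add_mul]
    have e1 := integral_add (h.memLp.integrable_mul (hψ.memLp_grad i))
      (h'.memLp.integrable_mul (hψ.memLp_grad i))
    have e2 := integral_add ((memLp_coord h.memLp_grad i).integrable_mul hψ.memLp)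
      ((memLp_coord h'.memLp_grad i).integrable_mul hψ.memLp)
    simp only [Pi.mul_apply] at e1 e2
    rw [e1, e2, h1, h2]
    ring

lemma MemH1.const_mul (h : MemH1 Ω φ g) (c : ℂ) :
    MemH1 Ω (fun x => c * φ x) (fun x => c • g x) where
  memLp := h.memLp.const_mul c
  memLp_grad := h.memLp_grad.const_smul c
  weakGrad := by
    intro ψ hψ i
    have h1 := h.weakGrad ψ hψ i
    simp only [PiLp.smul_apply, smul_eq_mul, mul_assoc, integral_const_mul, h1]
    ring

lemma norm_conjVec (a : CVec d) : ‖conjVec a‖ = ‖a‖ := by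
  simp [EuclideanSpace.norm_eq, conjVec]

lemma conjVec_sub (a b : CVec d) : conjVec (a - b) = conjVec a - conjVec b := by
  ext i; simp [conjVec]

lemma continuous_conjVec : Continuous (conjVec : CVec d → CVec d) := by
  unfold conjVec; fun_prop

lemma MemH1.conj (h : MemH1 Ω φ g) : MemH1 Ω (fun x => star (φ x)) (fun x => conjVec (g x)) where
  memLp := h.memLp.star
  memLp_grad := h.memLp_grad.of_le (continuous_conjVec.comp_aestronglyMeasurable h.memLp_grad.1)
    (Eventually.of_forall fun x => (norm_conjVec _).le)
  weakGrad := by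
    intro ψ hψ i
    have h1 := congrArg (starRingEnd ℂ) (h.weakGrad _ hψ.conj i)
    rw [map_neg, ← integral_conj, ← integral_conj] at h1
    simp only [grad_conj, conjVec] at h1
    simpa [conjVec] using h1

lemma IsDirichletTrace.zero : IsDirichletTrace Ω (fun _ => 0) (fun _ => 0) 0 := by
  have hg : ∀ x : Space d, grad (fun _ => (0 : ℂ)) x = 0 := by
    intro x; ext i; simp [grad]
  refine ⟨fun _ _ => 0, fun _ => contDiff_const, fun R => ?_, fun R => ?_, ?_⟩
  · simp
  · simp [hg]
  · have : eLpNorm (fun x => (0 : ℂ) - (0 : Lp ℂ 2 (bdry Ω)) x) 2 (bdry Ω) = 0 := by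
      rw [eLpNorm_congr_ae (g := fun _ => (0 : ℂ)) ?_]
      · simp
      · filter_upwards [Lp.coeFn_zero ℂ 2 (bdry Ω)] with x hx
        rw [hx]
        simp
    simp only [this]
    exact tendsto_const_nhds

lemma MemH1.memH1Loc (h : MemH1 Ω φ g) : MemH1Loc Ω φ g where
  memL2Loc := fun _ => h.memLp.mono_measure (Measure.restrict_mono inter_subset_left le_rfl)
  memL2Loc_grad := fun _ => h.memLp_grad.mono_measure
    (Measure.restrict_mono inter_subset_left le_rfl)
  weakGrad := h.weakGrad

lemma continuous_grad {ψ : Space d → ℂ} (h : ContDiff ℝ ∞ ψ) : Continuous (grad ψ) := by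
  have hc : ∀ i : Fin d, Continuous (fun x => fderiv ℝ ψ x (EuclideanSpace.single i 1)) :=
    fun i => (h.continuous_fderiv (by simp)).clm_apply continuous_const
  unfold grad; fun_prop

lemma tendsto_eLpNorm_add {F : Type*} [NormedAddCommGroup F] {ν : Measure (Space d)}
    {a a' : ℕ → Space d → F} {b b' : Space d → F}
    (ha : ∀ n, AEStronglyMeasurable (a n) ν) (ha' : ∀ n, AEStronglyMeasurable (a' n) ν)
    (hb : AEStronglyMeasurable b ν) (hb' : AEStronglyMeasurable b' ν)
    (h : Tendsto (fun n => eLpNorm (fun x => a n x - b x) 2 ν) atTop (𝓝 0))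
    (h' : Tendsto (fun n => eLpNorm (fun x => a' n x - b' x) 2 ν) atTop (𝓝 0)) :
    Tendsto (fun n => eLpNorm (fun x => (a n x + a' n x) - (b x + b' x)) 2 ν) atTop (𝓝 0) := by
  refine tendsto_of_tendsto_of_tendsto_of_le_of_le tendsto_const_nhds
    (by simpa using h.add h') (fun _ => zero_le) (fun n => ?_)
  refine le_trans (le_of_eq ?_) (eLpNorm_add_le ((ha n).sub hb) ((ha' n).sub hb') one_le_two)
  congr 1
  ext x
  exact add_sub_add_comm _ _ _ _

lemma tendsto_eLpNorm_smul {F : Type*} [NormedAddCommGroup F] [NormedSpace ℂ F]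
    {ν : Measure (Space d)} {a : ℕ → Space d → F} {b : Space d → F} (c : ℂ)
    (h : Tendsto (fun n => eLpNorm (fun x => a n x - b x) 2 ν) atTop (𝓝 0)) :
    Tendsto (fun n => eLpNorm (fun x => c • a n x - c • b x) 2 ν) atTop (𝓝 0) := by
  have e : ∀ n, eLpNorm (fun x => c • a n x - c • b x) 2 ν
      = ‖c‖ₑ * eLpNorm (fun x => a n x - b x) 2 ν := by
    intro n
    rw [← eLpNorm_const_smul]
    congr 1
    ext x
    simp [smul_sub]
  simp only [e]
  simpa using ENNReal.Tendsto.const_mul h (Or.inr enorm_ne_top)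

lemma IsDirichletTrace.add {t t' : Lp ℂ 2 (bdry Ω)} (hm : MemH1Loc Ω φ g) (hm' : MemH1Loc Ω φ' g')
    (h : IsDirichletTrace Ω φ g t) (h' : IsDirichletTrace Ω φ' g' t') :
    IsDirichletTrace Ω (fun x => φ x + φ' x) (fun x => g x + g' x) (t + t') := by
  obtain ⟨w, hw, h1, h2, h3⟩ := h
  obtain ⟨w', hw', h1', h2', h3'⟩ := h'
  refine ⟨fun n x => w n x + w' n x, fun n => (hw n).add (hw' n), fun R => ?_, fun R => ?_, ?_⟩
  · exact tendsto_eLpNorm_add (fun n => (hw n).continuous.aestronglyMeasurable)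
      (fun n => (hw' n).continuous.aestronglyMeasurable) (hm.memL2Loc R).1 (hm'.memL2Loc R).1
      (h1 R) (h1' R)
  · simp only [grad_add (hw _) (hw' _)]
    exact tendsto_eLpNorm_add (fun n => (continuous_grad (hw n)).aestronglyMeasurable)
      (fun n => (continuous_grad (hw' n)).aestronglyMeasurable) (hm.memL2Loc_grad R).1
      (hm'.memL2Loc_grad R).1 (h2 R) (h2' R)
  · have := tendsto_eLpNorm_add (fun n => (hw n).continuous.aestronglyMeasurable)
      (fun n => (hw' n).continuous.aestronglyMeasurable) (Lp.aestronglyMeasurable t)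
      (Lp.aestronglyMeasurable t') h3 h3'
    refine this.congr fun n => eLpNorm_congr_ae ?_
    filter_upwards [Lp.coeFn_add t t'] with x hx
    rw [hx, Pi.add_apply]

lemma IsDirichletTrace.const_mul {t : Lp ℂ 2 (bdry Ω)} (c : ℂ)
    (h : IsDirichletTrace Ω φ g t) :
    IsDirichletTrace Ω (fun x => c * φ x) (fun x => c • g x) (c • t) := by
  obtain ⟨w, hw, h1, h2, h3⟩ := h
  refine ⟨fun n x => c * w n x, fun n => contDiff_const.mul (hw n), fun R => ?_, fun R => ?_, ?_⟩
  · exact tendsto_eLpNorm_smul c (h1 R)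
  · simp only [grad_const_mul (hw _)]
    exact tendsto_eLpNorm_smul c (h2 R)
  · refine (tendsto_eLpNorm_smul c h3).congr fun n => eLpNorm_congr_ae ?_
    filter_upwards [Lp.coeFn_smul c t] with x hx
    rw [hx, Pi.smul_apply, smul_eq_mul, smul_eq_mul]

lemma IsDirichletTrace.conj {t : Lp ℂ 2 (bdry Ω)} (h : IsDirichletTrace Ω φ g t) :
    IsDirichletTrace Ω (fun x => star (φ x)) (fun x => conjVec (g x)) (star t) := by
  obtain ⟨w, hw, h1, h2, h3⟩ := h
  refine ⟨fun n x => star (w n x), fun n => (starL' ℝ : ℂ ≃L[ℝ] ℂ).contDiff.comp (hw n),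
    fun R => ?_, fun R => ?_, ?_⟩
  · refine (h1 R).congr fun n => eLpNorm_congr_norm_ae (Eventually.of_forall fun x => ?_)
    rw [← star_sub, norm_star]
  · refine (h2 R).congr fun n => eLpNorm_congr_norm_ae (Eventually.of_forall fun x => ?_)
    rw [grad_conj, ← conjVec_sub, norm_conjVec]
  · refine h3.congr fun n => eLpNorm_congr_norm_ae ?_
    filter_upwards [AEEqFun.coeFn_star (t : Space d →ₘ[bdry Ω] ℂ)] with x hx
    have hx' : (star t : Lp ℂ 2 (bdry Ω)) x = star (t x) := hx
    rw [hx', ← star_sub, norm_star]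

end TraceLemmas

/-- The space `H^{1/2}(∂Ω)` of Dirichlet traces of functions of `H¹(Ω)`. -/
def traceSpace (Ω : Set (Space d)) : Submodule ℂ (Lp ℂ 2 (bdry Ω)) where
  carrier := {t | ∃ φ g, MemH1 Ω φ g ∧ IsDirichletTrace Ω φ g t}
  zero_mem' := ⟨_, _, MemH1.zero, IsDirichletTrace.zero⟩
  add_mem' := by
    rintro t t' ⟨φ, g, h, ht⟩ ⟨φ', g', h', ht'⟩
    exact ⟨_, _, h.add h', ht.add h.memH1Loc h'.memH1Loc ht'⟩
  smul_mem' := by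
    rintro c t ⟨φ, g, h, ht⟩
    exact ⟨_, _, h.const_mul c, ht.const_mul c⟩

/-- Complex conjugate of a Dirichlet trace. -/
def conjD {Ω : Set (Space d)} (t : traceSpace Ω) : traceSpace Ω :=
  ⟨star (t : Lp ℂ 2 (bdry Ω)), by
    obtain ⟨φ, g, h, ht⟩ := t.2
    exact ⟨_, _, h.conj, ht.conj⟩⟩

/-- The space `H^{-1/2}(∂Ω)`: the dual of `H^{1/2}(∂Ω)`, the latter being normed by
`‖t‖ = inf {‖φ‖_{H¹(Ω)} : φ has trace t}`. Continuity of `p` is thus the existence of `C` with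
`|p t| ≤ C ‖φ‖_{H¹(Ω)}` for all `φ` with trace `t`. -/
def dualTraceSpace (Ω : Set (Space d)) : Submodule ℂ (Module.Dual ℂ (traceSpace Ω)) where
  carrier := {p | ∃ C : ℝ, ∀ (t : traceSpace Ω) φ g, MemH1 Ω φ g → IsDirichletTrace Ω φ g t →
    ‖p t‖ ≤ C * h1Norm Ω φ g}
  zero_mem' := ⟨0, by intros; simp⟩
  add_mem' := by
    rintro p q ⟨C, hp⟩ ⟨D, hq⟩
    refine ⟨C + D, fun t φ g h ht => ?_⟩
    calc ‖(p + q) t‖ ≤ ‖p t‖ + ‖q t‖ := norm_add_le _ _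
      _ ≤ (C + D) * h1Norm Ω φ g := by linarith [hp t φ g h ht, hq t φ g h ht]
  smul_mem' := by
    rintro c p ⟨C, hp⟩
    refine ⟨‖c‖ * C, fun t φ g h ht => ?_⟩
    calc ‖(c • p) t‖ = ‖c‖ * ‖p t‖ := norm_mul _ _
      _ ≤ ‖c‖ * (C * h1Norm Ω φ g) := mul_le_mul_of_nonneg_left (hp t φ g h ht) (norm_nonneg _)
      _ = ‖c‖ * C * h1Norm Ω φ g := by ring

lemma conjD_add {Ω : Set (Space d)} (s t : traceSpace Ω) : conjD (s + t) = conjD s + conjD t := by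
  apply Subtype.ext
  apply Lp.ext
  change ⇑(star ((s : Lp ℂ 2 (bdry Ω)) + (t : Lp ℂ 2 (bdry Ω)))) =ᵐ[bdry Ω]
    ⇑(star (s : Lp ℂ 2 (bdry Ω)) + star (t : Lp ℂ 2 (bdry Ω)))
  filter_upwards [Lp.coeFn_star ((s : Lp ℂ 2 (bdry Ω)) + (t : Lp ℂ 2 (bdry Ω))), Lp.coeFn_star (s : Lp ℂ 2 (bdry Ω)),
    Lp.coeFn_star (t : Lp ℂ 2 (bdry Ω)), Lp.coeFn_add (s : Lp ℂ 2 (bdry Ω)) (t : Lp ℂ 2 (bdry Ω)),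
    Lp.coeFn_add (star (s : Lp ℂ 2 (bdry Ω))) (star (t : Lp ℂ 2 (bdry Ω)))] with x h1 h2 h3 h4 h5
  rw [h1, h5, Pi.star_apply, h4, Pi.add_apply, Pi.add_apply, h2, h3, star_add,
    Pi.star_apply, Pi.star_apply]

lemma conjD_smul {Ω : Set (Space d)} (c : ℂ) (t : traceSpace Ω) :
    conjD (c • t) = star c • conjD t := by
  apply Subtype.ext
  apply Lp.ext
  change ⇑(star (c • (t : Lp ℂ 2 (bdry Ω)))) =ᵐ[bdry Ω] ⇑(star c • star (t : Lp ℂ 2 (bdry Ω)))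
  filter_upwards [Lp.coeFn_star (c • (t : Lp ℂ 2 (bdry Ω))), Lp.coeFn_star (t : Lp ℂ 2 (bdry Ω)),
    Lp.coeFn_smul c (t : Lp ℂ 2 (bdry Ω)),
    Lp.coeFn_smul (star c) (star (t : Lp ℂ 2 (bdry Ω)))] with x h1 h2 h3 h4
  rw [h1, h4, Pi.star_apply, h3, Pi.smul_apply, Pi.smul_apply, h2, star_smul, Pi.star_apply]

lemma h1Norm_conj (Ω : Set (Space d)) (φ : Space d → ℂ) (g : Space d → CVec d) :
    h1Norm Ω (fun x => star (φ x)) (fun x => conjVec (g x)) = h1Norm Ω φ g := by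
  simp only [h1Norm, norm_conjVec, norm_star]

/-- Complex conjugate of a Neumann trace: `⟨conj p, t⟩ = conj ⟨p, conj t⟩`. -/
def conjN {Ω : Set (Space d)} (p : dualTraceSpace Ω) : dualTraceSpace Ω :=
  ⟨{ toFun := fun t => star ((p : Module.Dual ℂ (traceSpace Ω)) (conjD t))
     map_add' := by intro s t; rw [conjD_add, map_add, star_add]
     map_smul' := by intro c t; rw [conjD_smul, map_smul]; simp }, by
    obtain ⟨C, hC⟩ := p.2
    refine ⟨C, fun t φ g h ht => ?_⟩
    have := hC (conjD t) _ _ h.conj ht.conj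
    rw [h1Norm_conj] at this
    simpa using this⟩

/-- Pairs of Dirichlet/Neumann data: `H^{1/2}(∂Ω) × H^{-1/2}(∂Ω)`. -/
abbrev TracePair (Ω : Set (Space d)) := traceSpace Ω × dualTraceSpace Ω

/-- Complex conjugate of a pair of traces. -/
def conjPair {Ω : Set (Space d)} (u : TracePair Ω) : TracePair Ω := (conjD u.1, conjN u.2)

/-- Duality pairing `⟨p, t⟩` between `H^{-1/2}(∂Ω)` and `H^{1/2}(∂Ω)` (bilinear). -/
def duality {Ω : Set (Space d)} (p : dualTraceSpace Ω) (t : traceSpace Ω) : ℂ :=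
  (p : Module.Dual ℂ (traceSpace Ω)) t

/-- Skew-symmetric bilinear pairing `⟦(u,p),(v,q)⟧ = ⟨q, u⟩ - ⟨p, v⟩` on pairs of traces. -/
def skew {Ω : Set (Space d)} (u v : TracePair Ω) : ℂ := duality v.2 u.1 - duality u.2 v.1

/-- The multi-trace space `∏_j H^{1/2}(∂Ω_j) × H^{-1/2}(∂Ω_j)`. -/
abbrev MultiTrace {J : ℕ} (Ω : Fin (J + 1) → Set (Space d)) := ∀ j, TracePair (Ω j)

/-- Complex conjugate of a multi-trace. -/
def conjMulti {J : ℕ} {Ω : Fin (J + 1) → Set (Space d)} (u : MultiTrace Ω) : MultiTrace Ω :=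
  fun j => conjPair (u j)

/-- Skew-symmetric bilinear pairing on the multi-trace space. -/
def multiSkew {J : ℕ} {Ω : Fin (J + 1) → Set (Space d)} (u v : MultiTrace Ω) : ℂ :=
  ∑ j, skew (u j) (v j)

/-! ### Cauchy data -/

/-- `p ∈ H^{-1/2}(∂Ω)` is the Neumann trace (outward normal derivative on `∂Ω`) of the function
`φ ∈ H¹_loc(Δ, closure Ω)` with weak gradient `g` and weak Laplacian `L`, in the usual weak sense:
`⟨p, w|_∂Ω⟩ = ∫_Ω ∇φ · ∇w + (Δφ) w` for all `w ∈ H¹(Ω)` with bounded support. -/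
def IsNeumannTrace (Ω : Set (Space d)) (g : Space d → CVec d) (L : Space d → ℂ)
    (p : dualTraceSpace Ω) : Prop :=
  ∀ (w : Space d → ℂ) (h : Space d → CVec d) (t : traceSpace Ω), MemH1 Ω w h →
    Bornology.IsBounded (Function.support w) → IsDirichletTrace Ω w h t →
      duality p t = ∫ x in Ω, (dot (g x) (h x) + L x * w x)

/-- `q = m p` in `H^{-1/2}(∂Ω)`, where `m` is a function on `∂Ω`: `⟨q, t⟩ = ⟨p, m t⟩`. -/
def IsProduct {Ω : Set (Space d)} (m : Space d → ℝ) (p q : dualTraceSpace Ω) : Prop :=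
  ∀ s t : traceSpace Ω,
    (∀ᵐ x ∂(bdry Ω), (s : Lp ℂ 2 (bdry Ω)) x = (m x : ℂ) * (t : Lp ℂ 2 (bdry Ω)) x) →
      duality q t = duality p s

/-- Sommerfeld radiation condition, for a function `φ` with gradient `g`:
`∫_{|x| = ρ} |∂_ρ φ - i κ₀ φ|² dσ_ρ → 0` as `ρ → ∞`. For an `H¹_loc` function the integral is
determined for almost every radius `ρ`, and the limit is taken through such radii. -/
def IsOutgoing (κ₀ : ℝ) (φ : Space d → ℂ) (g : Space d → CVec d) : Prop :=
  Tendsto (fun ρ : ℝ => ENNReal.ofReal (ρ ^ (d - 1)) *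
      ∫⁻ θ : Metric.sphere (0 : Space d) 1,
        ‖(∑ i, ((θ : Space d) i : ℂ) * g (ρ • (θ : Space d)) i)
          - Complex.I * κ₀ * φ (ρ • (θ : Space d))‖ₑ ^ 2
        ∂((volume : Measure (Space d)).toSphere))
    (atTop ⊓ ae volume) (𝓝 0)

/-- The set `𝒞⁺(Ω_j)` of pairs `(φ|_{∂Ω_j}, μ_j ∂_n φ|_{∂Ω_j})`, where `φ ∈ H¹_loc(Δ, closure Ω_j)`
solves `div(μ∇φ) + κ²φ = 0` in `Ω_j` and, if `j = 0`, is `κ₀`-outgoing. The boundary values of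
`μ_j = μ|_{Ω_j}` are obtained by continuous extension from `Ω_j`. -/
def cauchyData {J : ℕ} (Ω : Fin (J + 1) → Set (Space d)) (μ : Space d → ℝ) (κ : Space d → ℂ)
    (κ₀ : ℝ) (j : Fin (J + 1)) : Set (TracePair (Ω j)) :=
  {u | ∃ (φ : Space d → ℂ) (g : Space d → CVec d) (L : Space d → ℂ) (p : dualTraceSpace (Ω j)),
    MemH1LapLoc (Ω j) φ g L ∧
    IsWeakDiv (Ω j) (fun x => (μ x : ℂ) • g x) (fun x => -(κ x ^ 2 * φ x)) ∧
    (j = 0 → IsOutgoing κ₀ φ g) ∧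
    IsDirichletTrace (Ω j) φ g u.1 ∧
    IsNeumannTrace (Ω j) g L p ∧
    IsProduct (extendFrom (Ω j) μ) p u.2}

/-- `𝒞⁺(Γ) = 𝒞⁺(Ω_0) × ⋯ × 𝒞⁺(Ω_J)`. -/
def multiCauchyData {J : ℕ} (Ω : Fin (J + 1) → Set (Space d)) (μ : Space d → ℝ)
    (κ : Space d → ℂ) (κ₀ : ℝ) : Set (MultiTrace Ω) :=
  {u | ∀ j, u j ∈ cauchyData Ω μ κ κ₀ j}

end Helmholtz
end

/-!
Write `u = (φ|_∂Ω, μ ∂_n φ)`. Since `⟨conj p, t⟩ = conj ⟨p, conj t⟩`, the number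
`i ⟦u, conj u⟧` is `2 Im ⟨μ ∂_n φ, conj φ⟩` (`I_mul_skew_conjPair`), and it remains to see that this
flux is not positive.

Green's formula turns the flux into a volume integral. The pairing of `μ ∂_n φ` with `conj φ` is by
definition the pairing of `∂_n φ` with `μ conj φ`, so that `μ conj φ`, cut off far away by a radial
function `χ`, has to be recognised as an `H¹` function with the expected gradient and trace. Hence
the Leibniz rules for products with bounded Lipschitz functions: `IsWeakGrad.lipschitz_mul`,
`IsDirichletTrace.lipschitz_mul`, `ae_eq_of_isWeakDiv_lipschitz_smul`. They all follow from smooth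
approximation of a Lipschitz function, uniformly and with gradients that are bounded and converge
almost everywhere (`exists_smooth_approx`). The Leibniz rule for the divergence gives the equation
in the form `∇μ · ∇φ + μ Δφ = -κ² φ`, and the flux becomes the imaginary part of
`∫_Ω χ (μ |∇φ|² - κ² |φ|²) + ∫_Ω μ conj φ ∇φ · ∇χ` (`duality_conjD_eq`).

The first integral has nonpositive imaginary part because `Im κ² = 2 Re κ Im κ ≥ 0`. In a bounded
subdomain one takes `χ = 1` and is done. In `Ω_0`, `∇χ` is `-c x / |x|` with `0 ≤ c ≤ C`, and lives
in the shell `ρ ≤ |x| ≤ ρ + 1`, where `μ = 1`. With `r = ∂_ρ φ - i κ₀ φ`,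
`- Im (conj φ ∂_ρ φ) = - κ₀ |φ|² - Im (conj φ r) ≤ |r|² / (4 κ₀)` (`im_flux_le`). No decay of `φ`
itself is needed: the flux is at most `C / (4 κ₀)` times the integral of `|r|²` over the shell,
which tends to `0` as `ρ → ∞` by the radiation condition and polar coordinates
(`IsOutgoing.tendsto_shell`). The cutoff does not affect the trace, as the boundary of `Ω_0` is
bounded: the points above the Lipschitz graph are covered by the other, bounded, subdomains
(`IsSubdomainPartition.isBounded_frontier`).
-/

noncomputable section

namespace Helmholtz

variable {d : ℕ}

/-! ### Mollification of Lipschitz functions -/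

lemma norm_grad_apply_le {K : NNReal} {M : Space d → ℂ} (hM : LipschitzWith K M) (x : Space d)
    (i : Fin d) : ‖grad M x i‖ ≤ K := by
  change ‖fderiv ℝ M x (EuclideanSpace.single i 1)‖ ≤ K
  refine ((fderiv ℝ M x).le_opNorm _).trans ?_
  simpa using norm_fderiv_le_of_lipschitz ℝ hM

lemma norm_grad_le {K : NNReal} {M : Space d → ℂ} (hM : LipschitzWith K M) (x : Space d) :
    ‖grad M x‖ ≤ √(d * K ^ 2) := by
  rw [EuclideanSpace.norm_eq]
  refine Real.sqrt_le_sqrt ?_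
  calc ∑ i, ‖grad M x i‖ ^ 2 ≤ ∑ _i : Fin d, (K : ℝ) ^ 2 :=
        Finset.sum_le_sum fun i _ => pow_le_pow_left₀ (norm_nonneg _) (norm_grad_apply_le hM x i) 2
    _ = d * K ^ 2 := by simp

lemma measurable_grad (M : Space d → ℂ) : Measurable (grad M) :=
  (WithLp.measurable_toLp 2 (Fin d → ℂ)).comp
    (measurable_pi_lambda _ fun _ => measurable_fderiv_apply_const ℝ M _)

/-- Mollification by convolution. The gradients converge almost everywhere because the gradient of
the mollified function is the mollified gradient, by Rademacher's theorem and differentiation under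
the integral sign. -/
theorem exists_smooth_approx {K : NNReal} {M : Space d → ℂ} (hM : LipschitzWith K M) :
    ∃ m : ℕ → Space d → ℂ, (∀ n, ContDiff ℝ ∞ (m n)) ∧ (∀ n, LipschitzWith K (m n)) ∧
      (∀ n x, ‖m n x - M x‖ ≤ 1 / ((n : ℝ) + 1)) ∧
      ∀ᵐ x, Tendsto (fun n => grad (m n) x) atTop (𝓝 (grad M x)) := by
  have hpos : ∀ n : ℕ, 0 < 1 / (((K : ℝ) + 1) * ((n : ℝ) + 1)) := fun n => by positivity
  -- the radii are such that `M` varies by at most `1 / (n + 1)` on the support of the bump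
  let φ : ℕ → ContDiffBump (0 : Space d) := fun n =>
    { rIn := 1 / (((K : ℝ) + 1) * ((n : ℝ) + 1)) / 2
      rOut := 1 / (((K : ℝ) + 1) * ((n : ℝ) + 1))
      rIn_pos := half_pos (hpos n)
      rIn_lt_rOut := half_lt_self (hpos n) }
  have hφ : Tendsto (fun n => (φ n).rOut) atTop (𝓝 0) := by
    have := (tendsto_one_div_add_atTop_nhds_zero_nat (𝕜 := ℝ)).const_mul (1 / ((K : ℝ) + 1))
    rw [mul_zero] at this
    refine this.congr fun n => ?_
    change _ = 1 / (((K : ℝ) + 1) * ((n : ℝ) + 1))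
    field_simp
  let m : ℕ → Space d → ℂ := fun n x => ∫ z, (φ n).normed volume z • M (x - z)
  have hm : ∀ n, m n = MeasureTheory.convolution ((φ n).normed volume) M
      (ContinuousLinearMap.lsmul ℝ ℝ) volume := fun n => rfl
  have hφc : ∀ n, Continuous ((φ n).normed volume) := fun n => (φ n).continuous_normed
  have hφi : ∀ n, Integrable ((φ n).normed volume) volume := fun n => (φ n).integrable_normed
  have hint : ∀ n x, Integrable (fun z => (φ n).normed volume z • M (x - z)) volume := by
    intro n x
    refine Continuous.integrable_of_hasCompactSupport ?_ ?_
    · exact (hφc n).smul (hM.continuous.comp (continuous_const.sub continuous_id))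
    · exact (φ n).hasCompactSupport_normed.smul_right
  have hlip : ∀ n, LipschitzWith K (m n) := by
    intro n
    refine LipschitzWith.of_dist_le_mul fun x y => ?_
    rw [dist_eq_norm]
    change ‖(∫ z, (φ n).normed volume z • M (x - z)) - ∫ z, (φ n).normed volume z • M (y - z)‖ ≤ _
    rw [← integral_sub (hint n x) (hint n y)]
    have hb : ∀ z, ‖(φ n).normed volume z • M (x - z) - (φ n).normed volume z • M (y - z)‖
        ≤ (φ n).normed volume z * (K * dist x y) := by
      intro z
      rw [← smul_sub, norm_smul, Real.norm_of_nonneg ((φ n).nonneg_normed z)]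
      refine mul_le_mul_of_nonneg_left ?_ ((φ n).nonneg_normed z)
      have := hM.dist_le_mul (x - z) (y - z)
      rwa [dist_sub_right, dist_eq_norm] at this
    refine (norm_integral_le_of_norm_le ((hφi n).mul_const _)
      (Eventually.of_forall hb)).trans (le_of_eq ?_)
    rw [integral_mul_const, (φ n).integral_normed, one_mul]
  have hder : ∀ n x, fderiv ℝ (m n) x = MeasureTheory.convolution ((φ n).normed volume)
      (fderiv ℝ M) (ContinuousLinearMap.lsmul ℝ ℝ) volume x := by
    intro n x
    refine HasFDerivAt.fderiv ?_
    have hrad : ∀ᵐ z, DifferentiableAt ℝ M (x - z) :=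
      (quasiMeasurePreserving_sub_left (volume : Measure (Space d)) x).ae hM.ae_differentiableAt
    refine (hasFDerivAt_integral_of_dominated_loc_of_lip (s := univ)
      (bound := fun z => (φ n).normed volume z * K)
      (F' := fun z => (φ n).normed volume z • fderiv ℝ M (x - z)) univ_mem
      (Eventually.of_forall fun y => (hint n y).1) (hint n x) ?_ ?_ ((hφi n).mul_const _) ?_).2
    · exact (hφc n).aestronglyMeasurable.smul
        ((measurable_fderiv ℝ M).comp (measurable_const.sub measurable_id)).aestronglyMeasurable
    · refine Eventually.of_forall fun z => LipschitzOnWith.of_dist_le_mul fun a _ b _ => ?_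
      have h0 := (φ n).nonneg_normed (μ := volume) z
      rw [dist_eq_norm, ← smul_sub, norm_smul, Real.norm_of_nonneg h0, Real.coe_nnabs,
        abs_of_nonneg (by positivity), mul_assoc]
      refine mul_le_mul_of_nonneg_left ?_ h0
      have := hM.dist_le_mul (a - z) (b - z)
      rwa [dist_sub_right, dist_eq_norm] at this
    · filter_upwards [hrad] with z hz
      have := hz.hasFDerivAt.comp x ((hasFDerivAt_id x).sub_const z)
      exact this.const_smul ((φ n).normed volume z)
  refine ⟨m, fun n => ?_, hlip, fun n x => ?_, ?_⟩
  · rw [hm]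
    exact (φ n).hasCompactSupport_normed.contDiff_convolution_left _ (φ n).contDiff_normed
      hM.continuous.locallyIntegrable
  · rw [← dist_eq_norm, hm]
    refine (φ n).dist_normed_convolution_le hM.continuous.aestronglyMeasurable fun y hy => ?_
    refine (hM.dist_le_mul y x).trans ?_
    have h1 : dist y x ≤ 1 / (((K : ℝ) + 1) * ((n : ℝ) + 1)) := (Metric.mem_ball.1 hy).le
    have h2 : (K : ℝ) / (K + 1) ≤ 1 := by
      rw [div_le_one (by positivity)]; linarith
    calc (K : ℝ) * dist y x ≤ K * (1 / (((K : ℝ) + 1) * ((n : ℝ) + 1))) :=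
          mul_le_mul_of_nonneg_left h1 K.2
      _ = (K : ℝ) / (K + 1) * (1 / ((n : ℝ) + 1)) := by field_simp
      _ ≤ 1 * (1 / ((n : ℝ) + 1)) := mul_le_mul_of_nonneg_right h2 (by positivity)
      _ = _ := one_mul _
  · have hloc : LocallyIntegrable (fderiv ℝ M) volume := by
      refine (memLp_top_of_bound (measurable_fderiv ℝ M).aestronglyMeasurable (K : ℝ)
        (Eventually.of_forall fun x => ?_)).locallyIntegrable le_top
      exact norm_fderiv_le_of_lipschitz ℝ hM
    filter_upwards [ContDiffBump.ae_convolution_tendsto_right_of_locallyIntegrable (K := 2) hφ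
      (Eventually.of_forall fun n => (by change (φ n).rOut ≤ 2 * ((φ n).rOut / 2); linarith))
      hloc] with x hx
    have hx' : Tendsto (fun n => fderiv ℝ (m n) x) atTop (𝓝 (fderiv ℝ M x)) := by
      simpa only [hder] using hx
    refine ((PiLp.continuous_toLp 2 (fun _ : Fin d => ℂ)).tendsto _).comp
      (tendsto_pi_nhds.2 fun i => ?_)
    exact ((ContinuousLinearMap.apply ℝ ℂ (EuclideanSpace.single i (1 : ℝ))).continuous.tendsto
      _).comp hx'

/-! ### Products with Lipschitz functions -/

lemma dot_eq_inner (a b : CVec d) : dot a b = inner ℂ (conjVec a) b := by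
  simp [dot, conjVec, PiLp.inner_apply, mul_comm]

lemma norm_dot_le (a b : CVec d) : ‖dot a b‖ ≤ ‖a‖ * ‖b‖ := by
  rw [dot_eq_inner, ← norm_conjVec a]
  exact norm_inner_le_norm _ _

lemma continuous_dot : Continuous fun p : CVec d × CVec d => dot p.1 p.2 := by
  unfold dot; fun_prop

lemma aestronglyMeasurable_dot {ν : Measure (Space d)} {a b : Space d → CVec d}
    (ha : AEStronglyMeasurable a ν) (hb : AEStronglyMeasurable b ν) :
    AEStronglyMeasurable (fun x => dot (a x) (b x)) ν := by
  have h := continuous_dot.comp_aestronglyMeasurable (ha.prodMk hb)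
  exact h

lemma continuous_dot_right (a : CVec d) : Continuous (dot a) := by
  unfold dot; fun_prop

lemma dot_add (a b c : CVec d) : dot a (b + c) = dot a b + dot a c := by
  simp [dot, mul_add, Finset.sum_add_distrib]

lemma dot_smul (z : ℂ) (a b : CVec d) : dot a (z • b) = z * dot a b := by
  simp only [dot, PiLp.smul_apply, smul_eq_mul, Finset.mul_sum]
  exact Finset.sum_congr rfl fun i _ => by ring

lemma smul_dot (z : ℂ) (a b : CVec d) : dot (z • a) b = z * dot a b := by
  simp only [dot, PiLp.smul_apply, smul_eq_mul, Finset.mul_sum]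
  exact Finset.sum_congr rfl fun i _ => by ring

lemma dot_conjVec_self (a : CVec d) : dot a (conjVec a) = ((‖a‖ ^ 2 : ℝ) : ℂ) := by
  rw [EuclideanSpace.norm_sq_eq]
  simp [dot, conjVec, Complex.mul_conj, Complex.normSq_eq_norm_sq]

lemma grad_mul {a b : Space d → ℂ} {x : Space d} (ha : DifferentiableAt ℝ a x)
    (hb : DifferentiableAt ℝ b x) :
    grad (fun y => a y * b y) x = a x • grad b x + b x • grad a x := by
  ext i
  have e : fderiv ℝ (fun y => a y * b y) x = a x • fderiv ℝ b x + b x • fderiv ℝ a x :=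
    fderiv_fun_mul ha hb
  simp [grad, e]

lemma tendsto_eLpNorm_zero_add {F : Type*} [NormedAddCommGroup F] {ν : Measure (Space d)}
    {a b : ℕ → Space d → F} (ha : ∀ n, AEStronglyMeasurable (a n) ν)
    (hb : ∀ n, AEStronglyMeasurable (b n) ν)
    (h : Tendsto (fun n => eLpNorm (a n) 2 ν) atTop (𝓝 0))
    (h' : Tendsto (fun n => eLpNorm (b n) 2 ν) atTop (𝓝 0)) :
    Tendsto (fun n => eLpNorm (fun x => a n x + b n x) 2 ν) atTop (𝓝 0) :=
  tendsto_of_tendsto_of_tendsto_of_le_of_le tendsto_const_nhds (by simpa using h.add h')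
    (fun _ => zero_le) fun n => eLpNorm_add_le (ha n) (hb n) one_le_two

lemma tendsto_eLpNorm_zero_of_le_mul {F F' : Type*} [NormedAddCommGroup F]
    [NormedAddCommGroup F'] {ν : Measure (Space d)} {a : ℕ → Space d → F}
    {b : ℕ → Space d → F'} (C : ℝ) (hab : ∀ n x, ‖b n x‖ ≤ C * ‖a n x‖)
    (h : Tendsto (fun n => eLpNorm (a n) 2 ν) atTop (𝓝 0)) :
    Tendsto (fun n => eLpNorm (b n) 2 ν) atTop (𝓝 0) := by
  refine tendsto_of_tendsto_of_tendsto_of_le_of_le tendsto_const_nhds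
    (by simpa using ENNReal.Tendsto.const_mul h (Or.inr (ENNReal.ofReal_ne_top (r := C))))
    (fun _ => zero_le) fun n =>
      eLpNorm_le_mul_eLpNorm_of_ae_le_mul (Eventually.of_forall (hab n)) 2

/-- Dominated convergence in `L²`. -/
lemma tendsto_eLpNorm_zero_of_dominated {F F' : Type*} [NormedAddCommGroup F]
    [NormedAddCommGroup F'] {ν : Measure (Space d)} {f : Space d → F} {b : ℕ → Space d → F'}
    (C : ℝ) (hf : MemLp f 2 ν) (hb : ∀ n, AEStronglyMeasurable (b n) ν)
    (hle : ∀ n x, ‖b n x‖ ≤ C * ‖f x‖) (hlim : ∀ᵐ x ∂ν, Tendsto (fun n => b n x) atTop (𝓝 0)) :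
    Tendsto (fun n => eLpNorm (b n) 2 ν) atTop (𝓝 0) := by
  have key : Tendsto (fun n => ∫⁻ x, ‖b n x‖ₑ ^ (2 : ℝ) ∂ν) atTop (𝓝 (∫⁻ _, 0 ∂ν)) := by
    refine tendsto_lintegral_of_dominated_convergence' (fun x => ‖C * ‖f x‖‖ₑ ^ (2 : ℝ))
      (fun n => ((hb n).enorm.pow_const _)) (fun n => Eventually.of_forall fun x => ?_) ?_ ?_
    · refine ENNReal.rpow_le_rpow ?_ (by norm_num)
      rw [← ofReal_norm, ← ofReal_norm]
      exact ENNReal.ofReal_le_ofReal ((hle n x).trans (le_abs_self _))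
    · have := (lintegral_rpow_enorm_lt_top_of_eLpNorm_lt_top (by simp) (by simp)
        (hf.norm.const_mul C).2).ne
      simpa using this
    · filter_upwards [hlim] with x hx
      have h1 := (ENNReal.continuous_rpow_const (y := 2)).tendsto _ |>.comp hx.enorm
      simpa [Function.comp_def] using h1
  have h2 := (ENNReal.continuous_rpow_const (y := 1 / 2)).tendsto _ |>.comp key
  simp only [lintegral_zero] at h2
  rw [ENNReal.zero_rpow_of_pos (by norm_num)] at h2
  refine h2.congr fun n => ?_
  rw [eLpNorm_eq_lintegral_rpow_enorm_toReal (by simp) (by simp)]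
  simp

section Products

variable {Ω : Set (Space d)} {φ : Space d → ℂ} {g : Space d → CVec d}

/-- A first order linear identity for all smooth functions extends to Lipschitz functions. -/
theorem integral_eq_zero_of_lipschitz {ν : Measure (Space d)} (hν : ν ≪ volume) {A : Space d → ℂ}
    {V : Space d → CVec d} (hA : Integrable A ν) (hV : Integrable V ν)
    (h : ∀ m : Space d → ℂ, ContDiff ℝ ∞ m → ∫ x, (m x * A x + dot (V x) (grad m x)) ∂ν = 0)
    {K : NNReal} {B : ℝ} {M : Space d → ℂ} (hM : LipschitzWith K M) (hB : ∀ x, ‖M x‖ ≤ B) :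
    ∫ x, (M x * A x + dot (V x) (grad M x)) ∂ν = 0 := by
  obtain ⟨m, hsm, hlip, hunif, hgrad⟩ := exists_smooth_approx hM
  have hlim : Tendsto (fun n => ∫ x, (m n x * A x + dot (V x) (grad (m n) x)) ∂ν) atTop
      (𝓝 (∫ x, (M x * A x + dot (V x) (grad M x)) ∂ν)) := by
    refine tendsto_integral_of_dominated_convergence
      (fun x => (B + 1) * ‖A x‖ + ‖V x‖ * √(d * K ^ 2)) (fun n => ?_)
      ((hA.norm.const_mul _).add (hV.norm.mul_const _)) (fun n => Eventually.of_forall fun x => ?_)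
      ?_
    · have h1 : AEStronglyMeasurable (fun x => m n x * A x) ν :=
        (hsm n).continuous.aestronglyMeasurable.mul hA.1
      have h2 : AEStronglyMeasurable (fun x => dot (V x) (grad (m n) x)) ν :=
        aestronglyMeasurable_dot hV.1 (continuous_grad (hsm n)).aestronglyMeasurable
      exact h1.add h2
    · refine (norm_add_le _ _).trans (add_le_add ?_ ?_)
      · rw [norm_mul]
        refine mul_le_mul_of_nonneg_right ?_ (norm_nonneg _)
        have h1 : (1 : ℝ) / ((n : ℝ) + 1) ≤ 1 := by
          rw [div_le_one (by positivity)]; linarith [(n.cast_nonneg : (0 : ℝ) ≤ n)]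
        have h2 := norm_le_norm_add_norm_sub' (m n x) (M x)
        linarith [hB x, hunif n x]
      · exact (norm_dot_le _ _).trans
          (mul_le_mul_of_nonneg_left (norm_grad_le (hlip n) x) (norm_nonneg _))
    · filter_upwards [hν.ae_le hgrad] with x hx
      have h1 : Tendsto (fun n => m n x) atTop (𝓝 (M x)) :=
        tendsto_iff_norm_sub_tendsto_zero.2 (squeeze_zero (fun _ => norm_nonneg _)
          (fun n => hunif n x) tendsto_one_div_add_atTop_nhds_zero_nat)
      have h2 : Tendsto (fun n => dot (V x) (grad (m n) x)) atTop (𝓝 (dot (V x) (grad M x))) :=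
        ((continuous_dot_right (V x)).tendsto _).comp hx
      exact (h1.mul_const _).add h2
  exact tendsto_nhds_unique (hlim.congr fun n => h _ (hsm n)) tendsto_const_nhds

lemma MemL2Loc.integrable_smul {F : Type*} [NormedAddCommGroup F] [NormedSpace ℂ F]
    {f : Space d → F} (hf : MemL2Loc Ω f) (hΩ : MeasurableSet Ω) {η : Space d → ℂ}
    (hη : Continuous η) (hc : HasCompactSupport η) :
    Integrable (fun x => η x • f x) (volume.restrict Ω) := by
  obtain ⟨R, hR⟩ := hc.isCompact.isBounded.subset_ball 0
  have h1 : IntegrableOn (fun x => η x • f x) (Ω ∩ Metric.ball 0 R) := by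
    have h2 : MemLp η 2 (volume.restrict (Ω ∩ Metric.ball 0 R)) :=
      hη.memLp_of_hasCompactSupport hc
    exact memLp_one_iff_integrable.1 ((hf R).smul h2)
  refine h1.of_forall_sdiff_eq_zero hΩ fun x hx => ?_
  have : x ∉ tsupport η := fun h => hx.2 ⟨hx.1, hR h⟩
  rw [image_eq_zero_of_notMem_tsupport this, zero_smul]

lemma IsTest.continuous_grad_apply {ψ : Space d → ℂ} (h : IsTest Ω ψ) (i : Fin d) :
    Continuous (fun x => grad ψ x i) :=
  (h.1.continuous_fderiv (by simp)).clm_apply continuous_const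

lemma IsTest.hasCompactSupport_grad_apply {ψ : Space d → ℂ} (h : IsTest Ω ψ) (i : Fin d) :
    HasCompactSupport (fun x => grad ψ x i) :=
  h.2.1.fderiv_apply (𝕜 := ℝ) _

lemma IsTest.smooth_mul {ψ m : Space d → ℂ} (h : IsTest Ω ψ) (hm : ContDiff ℝ ∞ m) :
    IsTest Ω (fun x => m x * ψ x) :=
  ⟨hm.mul h.1, h.2.1.mul_left, (tsupport_mul_subset_right).trans h.2.2⟩

lemma MemL2Loc.coord (hg : MemL2Loc Ω g) (i : Fin d) : MemL2Loc Ω (fun x => g x i) :=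
  fun R => memLp_coord (hg R) i

lemma MemL2Loc.integrable_dot_grad (hg : MemL2Loc Ω g) (hΩ : MeasurableSet Ω) {ψ : Space d → ℂ}
    (hψ : IsTest Ω ψ) : Integrable (fun x => dot (g x) (grad ψ x)) (volume.restrict Ω) := by
  unfold dot
  refine integrable_finsetSum _ fun i _ => ?_
  refine ((hg.coord i).integrable_smul hΩ (hψ.continuous_grad_apply i)
    (hψ.hasCompactSupport_grad_apply i)).congr (Eventually.of_forall fun x => ?_)
  exact mul_comm _ _

lemma _root_.MeasureTheory.MemLp.lipschitz_mul {ν : Measure (Space d)} (hφ : MemLp φ 2 ν)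
    {K : NNReal} {B : ℝ} {M : Space d → ℂ} (hM : LipschitzWith K M) (hB : ∀ x, ‖M x‖ ≤ B) :
    MemLp (fun x => M x * φ x) 2 ν := by
  refine hφ.of_le_mul (c := B) (hM.continuous.aestronglyMeasurable.mul hφ.1)
    (Eventually.of_forall fun x => ?_)
  rw [norm_mul]
  exact mul_le_mul_of_nonneg_right (hB x) (norm_nonneg _)

lemma _root_.MeasureTheory.MemLp.lipschitz_mul_grad {ν : Measure (Space d)} (hφ : MemLp φ 2 ν)
    (hg : MemLp g 2 ν) {K : NNReal} {B : ℝ} {M : Space d → ℂ} (hM : LipschitzWith K M)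
    (hB : ∀ x, ‖M x‖ ≤ B) :
    MemLp (fun x => M x • g x + φ x • grad M x) 2 ν := by
  have h1 : MemLp (fun x => M x • g x) 2 ν := by
    refine hg.of_le_mul (c := B) (hM.continuous.aestronglyMeasurable.smul hg.1)
      (Eventually.of_forall fun x => ?_)
    rw [norm_smul]
    exact mul_le_mul_of_nonneg_right (hB x) (norm_nonneg _)
  have h2 : MemLp (fun x => φ x • grad M x) 2 ν := by
    refine hφ.of_le_mul (c := √(d * K ^ 2)) (hφ.1.smul (measurable_grad M).aestronglyMeasurable)
      (Eventually.of_forall fun x => ?_)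
    rw [norm_smul, mul_comm]
    exact mul_le_mul_of_nonneg_right (norm_grad_le hM x) (norm_nonneg _)
  exact h1.add h2

/-- Leibniz rule for the weak gradient. -/
theorem IsWeakGrad.lipschitz_mul (hΩ : MeasurableSet Ω) (hφ : MemL2Loc Ω φ) (hg : MemL2Loc Ω g)
    (h : IsWeakGrad Ω φ g) {K : NNReal} {B : ℝ} {M : Space d → ℂ} (hM : LipschitzWith K M)
    (hB : ∀ x, ‖M x‖ ≤ B) :
    IsWeakGrad Ω (fun x => M x * φ x) (fun x => M x • g x + φ x • grad M x) := by
  intro ψ hψ i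
  have i1 := hφ.integrable_smul hΩ (hψ.continuous_grad_apply i)
    (hψ.hasCompactSupport_grad_apply i)
  have i2 := (hg.coord i).integrable_smul hΩ hψ.1.continuous hψ.2.1
  have i3 := hφ.integrable_smul hΩ hψ.1.continuous hψ.2.1
  have e : ∀ (c : ℂ) (v : CVec d), dot (c • EuclideanSpace.single i (1 : ℂ)) v = c * v i := by
    intro c v
    rw [smul_dot]
    simp [dot]
  have key := integral_eq_zero_of_lipschitz (ν := volume.restrict Ω)
    Measure.absolutelyContinuous_restrict
    (i1.add i2) (i3.smul_const (EuclideanSpace.single i (1 : ℂ) : CVec d)) (M := M) (K := K)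
    (B := B) ?_ hM hB
  · simp only [e, Pi.add_apply, smul_eq_mul] at key
    rw [← sub_eq_zero, sub_neg_eq_add, ← integral_add, ← key]
    · refine integral_congr_ae (Eventually.of_forall fun x => ?_)
      simp only [PiLp.add_apply, PiLp.smul_apply, smul_eq_mul]
      ring
    · have hL : MemL2Loc Ω (fun x => M x * φ x) := fun R => (hφ R).lipschitz_mul hM hB
      refine (hL.integrable_smul hΩ (hψ.continuous_grad_apply i)
        (hψ.hasCompactSupport_grad_apply i)).congr (Eventually.of_forall fun x => ?_)
      exact mul_comm _ _
    · have hL : MemL2Loc Ω (fun x => M x • g x + φ x • grad M x) :=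
        fun R => (hφ R).lipschitz_mul_grad (hg R) hM hB
      refine ((hL.coord i).integrable_smul hΩ hψ.1.continuous hψ.2.1).congr
        (Eventually.of_forall fun x => ?_)
      exact mul_comm _ _
  · intro m hm
    have h1 := h _ (hψ.smooth_mul hm) i
    simp only [e, Pi.add_apply, smul_eq_mul]
    rw [← sub_eq_zero, sub_neg_eq_add, ← integral_add] at h1
    · rw [← h1]
      refine integral_congr_ae (Eventually.of_forall fun x => ?_)
      dsimp only
      rw [grad_mul (hm.differentiable (by simp) x) (hψ.1.differentiable (by simp) x)]
      simp only [PiLp.add_apply, PiLp.smul_apply, smul_eq_mul]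
      ring
    · refine (hφ.integrable_smul hΩ ((hψ.smooth_mul hm).continuous_grad_apply i)
        ((hψ.smooth_mul hm).hasCompactSupport_grad_apply i)).congr
        (Eventually.of_forall fun x => ?_)
      exact mul_comm _ _
    · refine ((hg.coord i).integrable_smul hΩ (hψ.smooth_mul hm).1.continuous
        (hψ.smooth_mul hm).2.1).congr (Eventually.of_forall fun x => ?_)
      exact mul_comm _ _

/-- Leibniz rule for the weak divergence: if `div (M g) = f` and `div g = L`, then
`f = ∇M · g + M L` almost everywhere. -/
theorem ae_eq_of_isWeakDiv_lipschitz_smul (hΩ : IsOpen Ω) {L f : Space d → ℂ}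
    (hg : MemL2Loc Ω g) (hL : MemL2Loc Ω L) (hf : MemL2Loc Ω f) (h : IsWeakDiv Ω g L)
    {K : NNReal} {B : ℝ} {M : Space d → ℂ} (hM : LipschitzWith K M) (hB : ∀ x, ‖M x‖ ≤ B)
    (hMf : IsWeakDiv Ω (fun x => M x • g x) f) :
    ∀ᵐ x ∂(volume.restrict Ω), f x = dot (g x) (grad M x) + M x * L x := by
  have hΩm := hΩ.measurableSet
  set D : Space d → ℂ := fun x => f x - (dot (g x) (grad M x) + M x * L x) with hD
  have hDL : MemL2Loc Ω D := by
    intro R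
    refine (hf R).sub (MemLp.add ?_ ((hL R).lipschitz_mul hM hB))
    refine (hg R).of_le_mul (c := √(d * K ^ 2))
      (aestronglyMeasurable_dot (hg R).1 (measurable_grad M).aestronglyMeasurable)
      (Eventually.of_forall fun x => (norm_dot_le _ _).trans ?_)
    rw [mul_comm]
    exact mul_le_mul_of_nonneg_right (norm_grad_le hM x) (norm_nonneg _)
  have hloc : LocallyIntegrableOn D Ω := by
    intro x hx
    refine ⟨Ω ∩ Metric.ball 0 (‖x‖ + 1), inter_mem self_mem_nhdsWithin
      (mem_nhdsWithin_of_mem_nhds (Metric.isOpen_ball.mem_nhds (by simp))), ?_⟩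
    have : IsFiniteMeasure ((volume : Measure (Space d)).restrict
        (Ω ∩ Metric.ball 0 (‖x‖ + 1))) := by
      refine isFiniteMeasure_restrict.2
        ((measure_mono inter_subset_right).trans_lt measure_ball_lt_top).ne
    exact (hDL _).integrable one_le_two
  have key : ∀ ψ, IsTest Ω ψ → ∫ x in Ω, ψ x * D x = 0 := by
    intro ψ hψ
    have i1 := hg.integrable_dot_grad hΩm hψ
    have i2 := hL.integrable_smul hΩm hψ.1.continuous hψ.2.1
    have i3 := hg.integrable_smul hΩm hψ.1.continuous hψ.2.1
    have i4 := hf.integrable_smul hΩm hψ.1.continuous hψ.2.1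
    simp only [smul_eq_mul] at i2 i4
    have hid := integral_eq_zero_of_lipschitz (ν := volume.restrict Ω)
      Measure.absolutelyContinuous_restrict (i1.add i2) i3 (M := M) (K := K) (B := B) ?_ hM hB
    · have h1 := hMf ψ hψ
      simp only [smul_dot, Pi.add_apply] at h1 hid
      have i5 : Integrable (fun x => M x * dot (g x) (grad ψ x)) (volume.restrict Ω) := by
        refine (i1.norm.const_mul B).mono' (hM.continuous.aestronglyMeasurable.mul i1.1)
          (Eventually.of_forall fun x => ?_)
        rw [norm_mul]
        exact mul_le_mul_of_nonneg_right (hB x) (norm_nonneg _)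
      have i6 := hDL.integrable_smul hΩm hψ.1.continuous hψ.2.1
      simp only [smul_eq_mul] at i6
      have i7 : Integrable (fun x => f x * ψ x) (volume.restrict Ω) :=
        i4.congr (Eventually.of_forall fun x => mul_comm _ _)
      rw [← sub_eq_zero, sub_neg_eq_add, ← integral_add i5 i7] at h1
      have i8 : Integrable (fun x => M x * dot (g x) (grad ψ x) + f x * ψ x)
        (volume.restrict Ω) := i5.add i7
      have e : ∀ x, M x * (dot (g x) (grad ψ x) + ψ x * L x) + ψ x * dot (g x) (grad M x)
          = (M x * dot (g x) (grad ψ x) + f x * ψ x) - ψ x * D x := fun x => by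
        simp only [hD]; ring
      simp only [e] at hid
      rw [integral_sub i8 i6, h1, zero_sub, neg_eq_zero] at hid
      exact hid
    · intro m hm
      have h1 := h _ (hψ.smooth_mul hm)
      have i5 := hL.integrable_smul hΩm (hψ.smooth_mul hm).1.continuous (hψ.smooth_mul hm).2.1
      rw [← sub_eq_zero, sub_neg_eq_add, ← integral_add (hg.integrable_dot_grad hΩm
        (hψ.smooth_mul hm)) (i5.congr (Eventually.of_forall fun x => mul_comm _ _))] at h1
      rw [← h1]
      refine integral_congr_ae (Eventually.of_forall fun x => ?_)
      dsimp only [Pi.add_apply]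
      rw [grad_mul (hm.differentiable (by simp) x) (hψ.1.differentiable (by simp) x)]
      simp only [dot_add, dot_smul, smul_dot]
      ring
  rw [ae_restrict_iff' hΩm]
  have hD0 := hΩ.ae_eq_zero_of_integral_contDiff_smul_eq_zero hloc fun ψ h1 h2 h3 => by
    have hs : tsupport (fun x => (ψ x : ℂ)) = tsupport ψ := by
      simp [tsupport, Function.support]
    rw [← key (fun x => (ψ x : ℂ)) ⟨Complex.ofRealCLM.contDiff.comp h1, by
      rwa [HasCompactSupport, hs], by rwa [hs]⟩]
    rw [← integral_indicator hΩm]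
    refine integral_congr_ae (Eventually.of_forall fun x => ?_)
    by_cases hx : x ∈ Ω
    · simp [hx, Complex.real_smul]
    · have : ψ x = 0 := image_eq_zero_of_notMem_tsupport fun h => hx (h3 h)
      simp [hx, this]
  filter_upwards [hD0] with x hx hxΩ
  exact sub_eq_zero.1 (hx hxΩ)

/-! ### Traces of products -/

/-- Multiplication by a bounded Lipschitz function commutes with taking Dirichlet traces. -/
theorem IsDirichletTrace.lipschitz_mul (hm : MemH1Loc Ω φ g)
    {t s : Lp ℂ 2 (bdry Ω)} (ht : IsDirichletTrace Ω φ g t)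
    {K : NNReal} {B : ℝ} {M : Space d → ℂ} (hM : LipschitzWith K M) (hB : ∀ x, ‖M x‖ ≤ B)
    (hs : ∀ᵐ x ∂(bdry Ω), s x = M x * t x) :
    IsDirichletTrace Ω (fun x => M x * φ x) (fun x => M x • g x + φ x • grad M x) s := by
  obtain ⟨m, hsm, hlip, hunif, hgrad⟩ := exists_smooth_approx hM
  obtain ⟨w, hw, h1, h2, h3⟩ := ht
  have hφ := hm.memL2Loc
  have hg := hm.memL2Loc_grad
  have hle : ∀ n x, ‖m n x - M x‖ ≤ 1 := fun n x => (hunif n x).trans (by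
    rw [div_le_one (by positivity)]; linarith [(n.cast_nonneg : (0 : ℝ) ≤ n)])
  have hmB : ∀ n x, ‖m n x‖ ≤ B + 1 := fun n x => by
    have h2 := norm_le_norm_add_norm_sub' (m n x) (M x)
    linarith [hB x, hle n x]
  have hlim : ∀ x, Tendsto (fun n => m n x - M x) atTop (𝓝 0) := fun x =>
    squeeze_zero_norm (fun n => hunif n x) tendsto_one_div_add_atTop_nhds_zero_nat
  have hmm : ∀ n (ν : Measure (Space d)), AEStronglyMeasurable (m n) ν :=
    fun n ν => (hsm n).continuous.aestronglyMeasurable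
  have hwm : ∀ n (ν : Measure (Space d)), AEStronglyMeasurable (w n) ν :=
    fun n ν => (hw n).continuous.aestronglyMeasurable
  have hMm : ∀ ν : Measure (Space d), AEStronglyMeasurable M ν :=
    fun ν => hM.continuous.aestronglyMeasurable
  have hgm : ∀ n (ν : Measure (Space d)), AEStronglyMeasurable (grad (m n)) ν :=
    fun n ν => (continuous_grad (hsm n)).aestronglyMeasurable
  have hgM : ∀ ν : Measure (Space d), AEStronglyMeasurable (grad M) ν :=
    fun ν => (measurable_grad M).aestronglyMeasurable
  -- convergence of the values is needed for the volume and for the surface measure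
  have hval : ∀ (ν : Measure (Space d)) (f : Space d → ℂ), MemLp f 2 ν →
      Tendsto (fun n => eLpNorm (fun x => w n x - f x) 2 ν) atTop (𝓝 0) →
      Tendsto (fun n => eLpNorm (fun x => m n x * w n x - M x * f x) 2 ν) atTop (𝓝 0) := by
    intro ν f hf hlw
    have e : ∀ n x, m n x * w n x - M x * f x
        = m n x * (w n x - f x) + (m n x - M x) * f x := fun n x => by ring
    simp only [e]
    refine tendsto_eLpNorm_zero_add (fun n => (hmm n ν).mul ((hwm n ν).sub hf.1))
      (fun n => ((hmm n ν).sub (hMm ν)).mul hf.1) ?_ ?_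
    · refine tendsto_eLpNorm_zero_of_le_mul (B + 1) (fun n x => ?_) hlw
      rw [norm_mul]
      exact mul_le_mul_of_nonneg_right (hmB n x) (norm_nonneg _)
    · refine tendsto_eLpNorm_zero_of_dominated 1 hf (fun n => ((hmm n ν).sub (hMm ν)).mul hf.1)
        (fun n x => ?_) (Eventually.of_forall fun x => ?_)
      · rw [norm_mul]
        exact mul_le_mul_of_nonneg_right (hle n x) (norm_nonneg _)
      · simpa using (hlim x).mul_const (f x)
  refine ⟨fun n x => m n x * w n x, fun n => (hsm n).mul (hw n),
    fun R => hval _ _ (hφ R) (h1 R), fun R => ?_, ?_⟩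
  · set ν := volume.restrict (Ω ∩ Metric.ball 0 R) with hν
    have hφm := (hφ R).1
    have hgm' := (hg R).1
    have hwg : ∀ n, AEStronglyMeasurable (grad (w n)) ν :=
      fun n => (continuous_grad (hw n)).aestronglyMeasurable
    have e : ∀ n x, grad (fun y => m n y * w n y) x - (M x • g x + φ x • grad M x)
        = (m n x • (grad (w n) x - g x) + (m n x - M x) • g x)
          + ((w n x - φ x) • grad (m n) x + φ x • (grad (m n) x - grad M x)) := fun n x => by
      rw [grad_mul ((hsm n).differentiable (by simp) x) ((hw n).differentiable (by simp) x)]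
      module
    simp only [e]
    have a1 : ∀ n, AEStronglyMeasurable (fun x => m n x • (grad (w n) x - g x)) ν :=
      fun n => (hmm n ν).smul ((hwg n).sub hgm')
    have a2 : ∀ n, AEStronglyMeasurable (fun x => (m n x - M x) • g x) ν :=
      fun n => ((hmm n ν).sub (hMm ν)).smul hgm'
    have a3 : ∀ n, AEStronglyMeasurable (fun x => (w n x - φ x) • grad (m n) x) ν :=
      fun n => ((hwm n ν).sub hφm).smul (hgm n ν)
    have a4 : ∀ n, AEStronglyMeasurable (fun x => φ x • (grad (m n) x - grad M x)) ν :=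
      fun n => hφm.smul ((hgm n ν).sub (hgM ν))
    refine tendsto_eLpNorm_zero_add (fun n => (a1 n).add (a2 n)) (fun n => (a3 n).add (a4 n))
      (tendsto_eLpNorm_zero_add a1 a2 ?_ ?_) (tendsto_eLpNorm_zero_add a3 a4 ?_ ?_)
    · refine tendsto_eLpNorm_zero_of_le_mul (B + 1) (fun n x => ?_) (h2 R)
      rw [norm_smul]
      exact mul_le_mul_of_nonneg_right (hmB n x) (norm_nonneg _)
    · refine tendsto_eLpNorm_zero_of_dominated 1 (hg R) a2 (fun n x => ?_)
        (Eventually.of_forall fun x => ?_)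
      · rw [norm_smul]
        exact mul_le_mul_of_nonneg_right (hle n x) (norm_nonneg _)
      · simpa using (hlim x).smul_const (g x)
    · refine tendsto_eLpNorm_zero_of_le_mul (√(d * K ^ 2)) (fun n x => ?_) (h1 R)
      rw [norm_smul, mul_comm]
      exact mul_le_mul_of_nonneg_right (norm_grad_le (hlip n) x) (norm_nonneg _)
    · refine tendsto_eLpNorm_zero_of_dominated (√(d * K ^ 2) + √(d * K ^ 2)) (hφ R) a4
        (fun n x => ?_) ?_
      · rw [norm_smul, mul_comm]
        exact mul_le_mul_of_nonneg_right ((norm_sub_le _ _).trans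
          (add_le_add (norm_grad_le (hlip n) x) (norm_grad_le hM x))) (norm_nonneg _)
      · filter_upwards [ae_restrict_of_ae hgrad] with x hx
        have := (tendsto_sub_nhds_zero_iff.2 hx).const_smul (φ x)
        simpa using this
  · refine (hval _ _ (Lp.memLp t) h3).congr fun n => eLpNorm_congr_ae ?_
    filter_upwards [hs] with x hx
    rw [hx]

lemma MemH1Loc.conj (h : MemH1Loc Ω φ g) :
    MemH1Loc Ω (fun x => star (φ x)) (fun x => conjVec (g x)) where
  memL2Loc := fun R => (h.memL2Loc R).star
  memL2Loc_grad := fun R => (h.memL2Loc_grad R).of_le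
    (continuous_conjVec.comp_aestronglyMeasurable (h.memL2Loc_grad R).1)
    (Eventually.of_forall fun _ => (norm_conjVec _).le)
  weakGrad := by
    intro ψ hψ i
    have h1 := congrArg (starRingEnd ℂ) (h.weakGrad _ hψ.conj i)
    rw [map_neg, ← integral_conj, ← integral_conj] at h1
    simp only [grad_conj, conjVec] at h1
    simpa [conjVec] using h1

lemma MemH1Loc.lipschitz_mul (hΩ : MeasurableSet Ω) (h : MemH1Loc Ω φ g) {K : NNReal} {B : ℝ}
    {M : Space d → ℂ} (hM : LipschitzWith K M) (hB : ∀ x, ‖M x‖ ≤ B) :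
    MemH1Loc Ω (fun x => M x * φ x) (fun x => M x • g x + φ x • grad M x) where
  memL2Loc := fun R => (h.memL2Loc R).lipschitz_mul hM hB
  memL2Loc_grad := fun R => (h.memL2Loc R).lipschitz_mul_grad (h.memL2Loc_grad R) hM hB
  weakGrad := h.weakGrad.lipschitz_mul hΩ h.memL2Loc h.memL2Loc_grad hM hB

/-- The product of an `H¹_loc` function with a compactly supported Lipschitz function is in
`H¹`. -/
theorem MemH1Loc.memH1_lipschitz_mul (hΩ : MeasurableSet Ω) (h : MemH1Loc Ω φ g)
    {K : NNReal} {B : ℝ} {M : Space d → ℂ} (hM : LipschitzWith K M) (hB : ∀ x, ‖M x‖ ≤ B)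
    (hc : HasCompactSupport M) :
    MemH1 Ω (fun x => M x * φ x) (fun x => M x • g x + φ x • grad M x) := by
  obtain ⟨R, hR⟩ := hc.isCompact.isBounded.subset_ball 0
  have ext : ∀ {F : Type} [NormedAddCommGroup F] (f : Space d → F),
      MemLp f 2 (volume.restrict (Ω ∩ Metric.ball 0 R)) → (∀ x ∉ Metric.ball 0 R, f x = 0) →
      MemLp f 2 (volume.restrict Ω) := by
    intro F _ f hf h0
    have e : (Metric.ball 0 R).indicator f = f := by
      rw [indicator_eq_self]
      exact fun x hx => by_contra fun h => hx (h0 x h)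
    rw [← e, memLp_indicator_iff_restrict Metric.isOpen_ball.measurableSet,
      Measure.restrict_restrict Metric.isOpen_ball.measurableSet, inter_comm]
    exact hf
  have hM0 : ∀ x ∉ Metric.ball (0 : Space d) R, M x = 0 := fun x hx =>
    image_eq_zero_of_notMem_tsupport fun h => hx (hR h)
  have hg0 : ∀ x ∉ Metric.ball (0 : Space d) R, grad M x = 0 := fun x hx => by
    have : fderiv ℝ M x = 0 := by
      by_contra h
      exact hx (hR (support_fderiv_subset ℝ h))
    ext i
    simp [grad, this]
  refine ⟨ext _ ((h.memL2Loc R).lipschitz_mul hM hB) fun x hx => ?_,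
    ext _ ((h.memL2Loc R).lipschitz_mul_grad (h.memL2Loc_grad R) hM hB) fun x hx => ?_,
    h.weakGrad.lipschitz_mul hΩ h.memL2Loc h.memL2Loc_grad hM hB⟩
  · rw [hM0 x hx, zero_mul]
  · rw [hM0 x hx, hg0 x hx, zero_smul, smul_zero, add_zero]

end Products

/-! ### Polar coordinates -/

/-- Integration in polar coordinates. Stated as an inequality, it needs no measurability of `F`. -/
lemma lintegral_le_lintegral_polar (hd : 1 ≤ d) (F : Space d → ℝ≥0∞) :
    ∫⁻ x, F x ≤ ∫⁻ r in Ioi (0 : ℝ), ENNReal.ofReal (r ^ (d - 1)) *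
      ∫⁻ θ : Metric.sphere (0 : Space d) 1, F (r • (θ : Space d))
        ∂((volume : Measure (Space d)).toSphere) := by
  have : Nonempty (Fin d) := ⟨⟨0, hd⟩⟩
  have : Nontrivial (Space d) := inferInstance
  have hmp := (volume : Measure (Space d)).measurePreserving_homeomorphUnitSphereProd
  rw [finrank_euclideanSpace_fin] at hmp
  have h1 : ∫⁻ x, F x = ∫⁻ y : ({0}ᶜ : Set (Space d)), F y
      ∂(Measure.comap Subtype.val (volume : Measure (Space d))) := by
    rw [lintegral_subtype_comap (measurableSet_singleton _).compl, restrict_compl_singleton]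
  have h2 := hmp.lintegral_comp_emb (homeomorphUnitSphereProd (Space d)).measurableEmbedding
    (fun p => F ((p.2 : ℝ) • (p.1 : Space d)))
  have h3 : ∀ y : ({0}ᶜ : Set (Space d)), ((homeomorphUnitSphereProd (Space d) y).2 : ℝ) •
      ((homeomorphUnitSphereProd (Space d) y).1 : Space d) = y := by
    intro y
    have : ‖(y : Space d)‖ ≠ 0 := norm_ne_zero_iff.2 y.2
    simp [smul_smul, this]
  simp only [h3] at h2
  rw [h1, h2, ← lintegral_prod_swap]
  refine (lintegral_prod_le _).trans ?_
  rw [Measure.volumeIoiPow]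
  refine (lintegral_withDensity_le_lintegral_mul _ (by fun_prop) _).trans ?_
  rw [← lintegral_subtype_comap measurableSet_Ioi]
  rfl

lemma lintegral_shell_le (hd : 1 ≤ d) (F : Space d → ℝ≥0∞) {a b : ℝ} (ha : 0 < a) :
    ∫⁻ x in {x | ‖x‖ ∈ Icc a b}, F x ≤ ∫⁻ r in Icc a b, ENNReal.ofReal (r ^ (d - 1)) *
      ∫⁻ θ : Metric.sphere (0 : Space d) 1, F (r • (θ : Space d))
        ∂((volume : Measure (Space d)).toSphere) := by
  have hS : MeasurableSet {x : Space d | ‖x‖ ∈ Icc a b} := measurable_norm measurableSet_Icc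
  rw [← lintegral_indicator hS]
  refine (lintegral_le_lintegral_polar hd _).trans ?_
  have hsub : Icc a b ⊆ Ioi (0 : ℝ) := fun r hr => ha.trans_le hr.1
  have hres : (volume : Measure ℝ).restrict (Icc a b)
      = (volume.restrict (Ioi 0)).restrict (Icc a b) := by
    rw [Measure.restrict_restrict measurableSet_Icc, inter_eq_self_of_subset_left hsub]
  rw [hres, ← lintegral_indicator measurableSet_Icc]
  refine setLIntegral_mono' measurableSet_Ioi fun r (hr : 0 < r) => ?_
  have hn : ∀ θ : Metric.sphere (0 : Space d) 1, ‖r • (θ : Space d)‖ = r := fun θ => by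
    rw [norm_smul, norm_eq_of_mem_sphere, mul_one, Real.norm_of_nonneg hr.le]
  by_cases h : r ∈ Icc a b
  · simp only [indicator_of_mem h]
    gcongr
    exact indicator_le_self _ _ _
  · have hout : ∀ θ : Metric.sphere (0 : Space d) 1,
        r • (θ : Space d) ∉ {x : Space d | ‖x‖ ∈ Icc a b} := fun θ hθ => h (by
      rw [← hn θ]; exact hθ)
    have h0 : ∀ θ : Metric.sphere (0 : Space d) 1,
        {x : Space d | ‖x‖ ∈ Icc a b}.indicator F (r • (θ : Space d)) = 0 :=
      fun θ => indicator_of_notMem (hout θ) F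
    exact (mul_eq_zero_of_right _ ((lintegral_congr h0).trans lintegral_zero)).le.trans zero_le

/-- The radiation condition makes the integral of `|∂_ρ φ - i κ₀ φ|²` over shells of
thickness one tend to zero. -/
theorem IsOutgoing.tendsto_shell (hd : 1 ≤ d) {κ₀ : ℝ} {φ : Space d → ℂ} {g : Space d → CVec d}
    (h : IsOutgoing κ₀ φ g) :
    Tendsto (fun ρ : ℝ => ∫⁻ x in {x : Space d | ‖x‖ ∈ Icc ρ (ρ + 1)},
      ‖(∑ i, ((x i / ‖x‖ : ℝ) : ℂ) * g x i) - Complex.I * κ₀ * φ x‖ₑ ^ 2) atTop (𝓝 0) := by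
  rw [ENNReal.tendsto_nhds_zero]
  intro ε hε
  have h1 := (ENNReal.tendsto_nhds_zero.1 h) ε hε
  obtain ⟨s, hs, t, ht, hst⟩ := Filter.eventually_inf.1 h1
  obtain ⟨R, hR⟩ := Filter.mem_atTop_sets.1 hs
  filter_upwards [eventually_ge_atTop R, eventually_gt_atTop 0] with ρ hρ hρ0
  refine (lintegral_shell_le hd _ hρ0).trans ?_
  calc _ ≤ ∫⁻ _ in Icc ρ (ρ + 1), ε := by
        refine setLIntegral_mono_ae' measurableSet_Icc ?_
        filter_upwards [ht] with r hrt hr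
        have hr0 : 0 < r := hρ0.trans_le hr.1
        refine le_trans (le_of_eq ?_) (hst r ⟨hR r (hρ.trans hr.1), hrt⟩)
        congr 1
        refine lintegral_congr fun θ => ?_
        have hn : ‖r • (θ : Space d)‖ = r := by
          rw [norm_smul, norm_eq_of_mem_sphere, mul_one, Real.norm_of_nonneg hr0.le]
        have hc : ∀ i, (r • (θ : Space d)) i / ‖r • (θ : Space d)‖ = (θ : Space d) i := by
          intro i
          rw [hn, PiLp.smul_apply, smul_eq_mul, mul_div_cancel_left₀ _ hr0.ne']
        simp only [hc]
    _ = ε := by simp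

/-! ### Radial cutoff functions -/

lemma deriv_smoothTransition_nonneg (s : ℝ) : 0 ≤ deriv Real.smoothTransition s :=
  Real.smoothTransition.monotone.deriv_nonneg

lemma deriv_smoothTransition_eq_zero {s : ℝ} (hs : s ∉ Icc (0 : ℝ) 1) :
    deriv Real.smoothTransition s = 0 := by
  have : (∃ c : ℝ, Real.smoothTransition =ᶠ[𝓝 s] fun _ => c) := by
    rcases lt_or_ge s 0 with h | h
    · exact ⟨0, (gt_mem_nhds h).mono fun t ht => Real.smoothTransition.zero_of_nonpos ht.le⟩
    · have h' : 1 < s := not_le.1 fun h1 => hs ⟨h, h1⟩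
      exact ⟨1, (lt_mem_nhds h').mono fun t ht => Real.smoothTransition.one_of_one_le ht.le⟩
  obtain ⟨c, hc⟩ := this
  rw [hc.deriv_eq, deriv_const]

lemma exists_deriv_smoothTransition_le :
    ∃ C : NNReal, ∀ s, deriv Real.smoothTransition s ≤ C := by
  have hc : Continuous (deriv Real.smoothTransition) :=
    (Real.smoothTransition.contDiff (n := 1)).continuous_deriv (by simp)
  obtain ⟨C, hC⟩ := isCompact_Icc.exists_bound_of_continuousOn (s := Icc (0 : ℝ) 1) hc.continuousOn
  refine ⟨C.toNNReal, fun s => ?_⟩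
  by_cases hs : s ∈ Icc (0 : ℝ) 1
  · exact ((le_abs_self _).trans (hC s hs)).trans (Real.le_coe_toNNReal C)
  · rw [deriv_smoothTransition_eq_zero hs]
    exact NNReal.coe_nonneg _

/-- Radial cutoff function: it equals `1` for `|x| ≤ ρ` and `0` for `|x| ≥ ρ + 1`. -/
def cutoff (ρ : ℝ) (x : Space d) : ℝ := Real.smoothTransition (ρ + 1 - ‖x‖)

lemma cutoff_nonneg (ρ : ℝ) (x : Space d) : 0 ≤ cutoff ρ x := Real.smoothTransition.nonneg _

lemma cutoff_le_one (ρ : ℝ) (x : Space d) : cutoff ρ x ≤ 1 := Real.smoothTransition.le_one _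

lemma cutoff_eq_one {ρ : ℝ} {x : Space d} (h : ‖x‖ ≤ ρ) : cutoff ρ x = 1 :=
  Real.smoothTransition.one_of_one_le (by linarith)

lemma support_cutoff_subset (ρ : ℝ) :
    Function.support (fun x : Space d => (cutoff ρ x : ℂ)) ⊆ Metric.closedBall 0 (ρ + 1) := by
  intro x hx
  rw [mem_closedBall_zero_iff]
  by_contra h
  refine hx ?_
  simp [cutoff, Real.smoothTransition.zero_of_nonpos (x := ρ + 1 - ‖x‖) (by linarith)]

lemma hasCompactSupport_cutoff (ρ : ℝ) :
    HasCompactSupport (fun x : Space d => (cutoff ρ x : ℂ)) :=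
  HasCompactSupport.of_support_subset_isCompact (isCompact_closedBall _ _)
    (support_cutoff_subset ρ)

lemma exists_lipschitzWith_cutoff (ρ : ℝ) :
    ∃ K : NNReal, LipschitzWith K (fun x : Space d => (cutoff ρ x : ℂ)) := by
  obtain ⟨C, hC⟩ := exists_deriv_smoothTransition_le
  have h1 : LipschitzWith C Real.smoothTransition := by
    refine lipschitzWith_of_nnnorm_deriv_le
      ((Real.smoothTransition.contDiff (n := 1)).differentiable (by simp)) fun s => ?_
    rw [← NNReal.coe_le_coe, coe_nnnorm, Real.norm_of_nonneg (deriv_smoothTransition_nonneg s)]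
    exact hC s
  have h2 : LipschitzWith 1 (fun x : Space d => ρ + 1 - ‖x‖) := by
    refine LipschitzWith.of_dist_le_mul fun x y => ?_
    rw [NNReal.coe_one, one_mul, Real.dist_eq, sub_sub_sub_cancel_left, dist_comm, dist_eq_norm]
    exact abs_norm_sub_norm_le y x
  exact ⟨_, Complex.isometry_ofReal.lipschitz.comp (h1.comp h2)⟩

lemma hasFDerivAt_norm_of_ne_zero {x : Space d} (hx : x ≠ 0) :
    HasFDerivAt (fun y : Space d => ‖y‖) (‖x‖⁻¹ • innerSL ℝ x) x := by
  have h := (hasStrictFDerivAt_norm_sq x).hasFDerivAt.sqrt (by simpa using hx)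
  simp only [Real.sqrt_sq (norm_nonneg _)] at h
  refine h.congr_fderiv ?_
  ext v
  simp
  ring

lemma dot_grad_cutoff (ρ : ℝ) {x : Space d} (hx : x ≠ 0) (a : CVec d) :
    dot a (grad (fun y => (cutoff ρ y : ℂ)) x)
      = -((deriv Real.smoothTransition (ρ + 1 - ‖x‖) : ℝ) : ℂ)
        * ∑ i, ((x i / ‖x‖ : ℝ) : ℂ) * a i := by
  have h1 : HasDerivAt Real.smoothTransition (deriv Real.smoothTransition (ρ + 1 - ‖x‖))
      (ρ + 1 - ‖x‖) :=
    ((Real.smoothTransition.contDiff (n := 1)).differentiable (by simp) _).hasDerivAt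
  have h2 := h1.comp_hasFDerivAt x ((hasFDerivAt_norm_of_ne_zero hx).const_sub (ρ + 1))
  have h3 := (Complex.ofRealCLM.hasFDerivAt.comp x h2).fderiv
  have h4 : fderiv ℝ (fun y : Space d => (cutoff ρ y : ℂ)) x = _ := h3
  simp only [dot, grad, h4, Finset.mul_sum]
  refine Finset.sum_congr rfl fun i _ => ?_
  simp [EuclideanSpace.inner_single_right]
  ring

/-! ### Geometry of the partition -/

lemma IsLipschitzOpen.exists_notMem_closure {Ω : Set (Space d)} (hΩ : IsLipschitzOpen Ω)
    {x : Space d} (hx : x ∈ frontier Ω) {ε : ℝ} (hε : 0 < ε) :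
    ∃ y ∈ Metric.ball x ε, y ∉ closure Ω := by
  obtain ⟨e, h, K, r, he, hh, hinv, hr, hloc⟩ := hΩ.2 x hx
  have hxΩ : x ∉ Ω := by
    rw [hΩ.1.frontier_eq] at hx
    exact hx.2
  have hx1 : h x ≤ inner ℝ e x := by
    have := mt (hloc x (Metric.mem_ball_self hr)).2 hxΩ
    exact not_lt.1 this
  -- a point strictly above the graph
  set s := min ε r / 2 with hs
  have hs0 : 0 < s := half_pos (lt_min hε hr)
  have hsm : s < min ε r := half_lt_self (lt_min hε hr)
  have hdist : dist (x + s • e) x = s := by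
    rw [dist_eq_norm, add_sub_cancel_left, norm_smul, he, mul_one, Real.norm_of_nonneg hs0.le]
  refine ⟨x + s • e, ?_, fun hcl => ?_⟩
  · rw [Metric.mem_ball, hdist]
    exact hsm.trans_le (min_le_left _ _)
  have hopen : IsOpen (Metric.ball x r ∩ {y | h y < inner ℝ e y}) :=
    Metric.isOpen_ball.inter (isOpen_lt hh.continuous (by fun_prop))
  have hy : x + s • e ∈ Metric.ball x r ∩ {y | h y < inner ℝ e y} := by
    refine ⟨?_, ?_⟩
    · rw [Metric.mem_ball, hdist]
      exact hsm.trans_le (min_le_right _ _)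
    · rw [mem_ofPred_eq, hinv, inner_add_right, inner_smul_right, real_inner_self_eq_norm_sq, he]
      linarith
  obtain ⟨z, ⟨hz1, hz2⟩, hzΩ⟩ := mem_closure_iff.1 hcl _ hopen hy
  exact lt_asymm hz2 ((hloc z hz1).1 hzΩ)

/-- The boundary of `Ω_0` lies in the closure of the union of the bounded subdomains. -/
lemma IsSubdomainPartition.isBounded_frontier {J : ℕ} {Ω : Fin (J + 1) → Set (Space d)}
    (hΩ : IsSubdomainPartition Ω) (j : Fin (J + 1)) : Bornology.IsBounded (frontier (Ω j)) := by
  by_cases hj : j = 0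
  · subst hj
    have hb : Bornology.IsBounded (⋃ k ∈ {k : Fin (J + 1) | k ≠ 0}, closure (Ω k)) :=
      (Bornology.isBounded_biUnion (toFinite _)).2 fun k hk => (hΩ.bounded k hk).closure
    refine hb.closure.subset fun x hx => ?_
    rw [Metric.mem_closure_iff]
    intro ε hε
    obtain ⟨y, hy, hy0⟩ := (hΩ.lipschitz 0).exists_notMem_closure hx hε
    obtain ⟨k, hk⟩ := mem_iUnion.1 (hΩ.covers.ge (mem_univ y))
    refine ⟨y, mem_biUnion (x := k) ?_ hk, by rwa [dist_comm]⟩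
    rintro rfl
    exact hy0 hk
  · exact (hΩ.bounded j hj).closure.subset frontier_subset_closure

/-! ### The energy inequality -/

lemma ofReal_im_integral_le {ν : Measure (Space d)} (f : Space d → ℂ) :
    ENNReal.ofReal (∫ x, f x ∂ν).im ≤ ∫⁻ x, ENNReal.ofReal (f x).im ∂ν := by
  by_cases hf : Integrable f ν
  · have h1 : (∫ x, f x ∂ν).im = ∫ x, (f x).im ∂ν := (integral_im hf).symm
    have h2 : Integrable (fun x => (f x).im) ν := hf.im
    rw [h1]
    calc ENNReal.ofReal (∫ x, (f x).im ∂ν) ≤ ENNReal.ofReal (∫ x, max (f x).im 0 ∂ν) :=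
          ENNReal.ofReal_le_ofReal (integral_mono h2 h2.pos_part fun x => le_max_left _ _)
      _ = ∫⁻ x, ENNReal.ofReal (max (f x).im 0) ∂ν :=
          ofReal_integral_eq_lintegral_ofReal h2.pos_part
            (Eventually.of_forall fun x => le_max_right _ _)
      _ = ∫⁻ x, ENNReal.ofReal (f x).im ∂ν := by
          refine lintegral_congr fun x => ?_
          rw [ENNReal.ofReal_max, ENNReal.ofReal_zero, max_eq_left zero_le]
  -- a divergent integral has the value `0`
  · rw [integral_undef hf]
    simp

/-- The flux is controlled by the defect `D - i κ₀ z` in the radiation condition: complete the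
square in `Im (conj z (D - i κ₀ z)) + κ₀ |z|²`. -/
lemma im_flux_le {κ₀ : ℝ} (hκ : 0 < κ₀) (z D : ℂ) :
    -(star z * D).im ≤ ‖D - Complex.I * κ₀ * z‖ ^ 2 / (4 * κ₀) := by
  rw [le_div_iff₀ (by positivity), ← Complex.normSq_eq_norm_sq, Complex.normSq_apply]
  simp
  nlinarith [sq_nonneg (2 * κ₀ * z.re + (D.im - κ₀ * z.re)),
    sq_nonneg (2 * κ₀ * z.im - (D.re + κ₀ * z.im))]

/-- A Lipschitz function on `Ω` with values in `[0, B]` extends to a bounded Lipschitz function on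
the whole space; on the boundary the extension is the one by continuity. -/
lemma exists_lipschitz_extension {Ω : Set (Space d)} {μ : Space d → ℝ} {K : NNReal} {B : ℝ}
    (hB : 0 ≤ B) (hμ : LipschitzOnWith K μ Ω) (hμB : ∀ x ∈ Ω, μ x ∈ Icc 0 B) :
    ∃ m : Space d → ℝ, LipschitzWith K (fun x => (m x : ℂ)) ∧ (∀ x ∈ Ω, m x = μ x) ∧
      (∀ x, ‖(m x : ℂ)‖ ≤ B) ∧ ∀ x ∈ frontier Ω, extendFrom Ω μ x = m x := by
  obtain ⟨m₀, hm₀, hm₀μ⟩ := hμ.extend_real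
  have hmlip : LipschitzWith K fun x => max 0 (min B (m₀ x)) := (hm₀.const_min B).const_max 0
  have hmμ : ∀ x ∈ Ω, max 0 (min B (m₀ x)) = μ x := fun x hx => by
    rw [← hm₀μ hx, min_eq_right (hμB x hx).2, max_eq_right (hμB x hx).1]
  refine ⟨fun x => max 0 (min B (m₀ x)), ?_, hmμ, fun x => ?_, fun x hx => ?_⟩
  · have := Complex.isometry_ofReal.lipschitz.comp hmlip
    rwa [one_mul] at this
  · rw [Complex.norm_real, Real.norm_of_nonneg (le_max_left _ _)]
    exact max_le hB (min_le_left _ _)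
  · refine extendFrom_eq (frontier_subset_closure hx) ?_
    refine ((hmlip.continuous.tendsto x).mono_left nhdsWithin_le_nhds).congr' ?_
    filter_upwards [self_mem_nhdsWithin] with y hy using hmμ y hy

/-- Pointwise form of Green's formula for a function with value `z` and gradient `a` against the
product of its conjugate with `m` and a cutoff `χ` (with gradients `G` and `H`): the energy terms
are real or have nonpositive imaginary part, and only the term with `H` remains. -/
lemma im_energy_density_le {a G H : CVec d} {z l k D : ℂ} {χ m c : ℝ}
    (hG : -(k ^ 2 * z) = dot a G + m * l) (hH : dot a H = -(c : ℂ) * D) (hχ : 0 ≤ χ)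
    (hk : 0 ≤ (k ^ 2).im) :
    (dot a ((χ : ℂ) • ((m : ℂ) • conjVec a + star z • G) + ((m : ℂ) * star z) • H)
      + l * ((χ : ℂ) * ((m : ℂ) * star z))).im ≤ m * c * -(star z * D).im := by
  have hzz : star z * z = ((‖z‖ ^ 2 : ℝ) : ℂ) := by
    rw [mul_comm]
    simp [Complex.mul_conj, Complex.normSq_eq_norm_sq]
  have hexp : dot a ((χ : ℂ) • ((m : ℂ) • conjVec a + star z • G) + ((m : ℂ) * star z) • H)
      + l * ((χ : ℂ) * ((m : ℂ) * star z))
      = ((χ * (m * ‖a‖ ^ 2) : ℝ) : ℂ) + ((-(χ * ‖z‖ ^ 2) : ℝ) : ℂ) * k ^ 2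
        + ((m * c : ℝ) : ℂ) * -(star z * D) := by
    rw [dot_add, dot_smul, dot_add, dot_smul, dot_smul, dot_smul, dot_conjVec_self, hH,
      ← sub_eq_iff_eq_add.2 hG]
    push_cast at hzz ⊢
    rw [← hzz]
    ring
  rw [hexp, Complex.add_im, Complex.add_im, Complex.ofReal_im, Complex.im_ofReal_mul,
    Complex.im_ofReal_mul, Complex.neg_im]
  linarith [mul_nonneg (mul_nonneg hχ (sq_nonneg ‖z‖)) hk]

/-- Green's formula for `φ` against `conj φ`, weighted by the coefficient `m` and truncated by a
radial cutoff that equals `1` on the boundary. -/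
theorem duality_conjD_eq {Ω : Set (Space d)} (hΩ : IsOpen Ω) {μ m : Space d → ℝ} {K : NNReal}
    {B : ℝ} (hmlip : LipschitzWith K (fun x => (m x : ℂ))) (hmB : ∀ x, ‖(m x : ℂ)‖ ≤ B)
    (hext : ∀ x ∈ frontier Ω, extendFrom Ω μ x = m x) {φ L : Space d → ℂ} {g : Space d → CVec d}
    {p q : dualTraceSpace Ω} {t : traceSpace Ω} (hφ : MemH1Loc Ω φ g)
    (ht : IsDirichletTrace Ω φ g t) (hp : IsNeumannTrace Ω g L p)
    (hq : IsProduct (extendFrom Ω μ) p q) {ρ : ℝ} (hfr : frontier Ω ⊆ Metric.closedBall 0 ρ) :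
    duality q (conjD t) = ∫ x in Ω, (dot (g x) ((cutoff ρ x : ℂ) • ((m x : ℂ) • conjVec (g x)
        + star (φ x) • grad (fun y => (m y : ℂ)) x)
        + ((m x : ℂ) * star (φ x)) • grad (fun y => (cutoff ρ y : ℂ)) x)
      + L x * ((cutoff ρ x : ℂ) * ((m x : ℂ) * star (φ x)))) := by
  have hΩm := hΩ.measurableSet
  obtain ⟨Kχ, hχlip⟩ := exists_lipschitzWith_cutoff (d := d) ρ
  have hχB : ∀ x : Space d, ‖(cutoff ρ x : ℂ)‖ ≤ 1 := fun x => by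
    rw [Complex.norm_real, Real.norm_of_nonneg (cutoff_nonneg ρ x)]
    exact cutoff_le_one ρ x
  have b := hφ.conj.lipschitz_mul hΩm hmlip hmB
  have hw := b.memH1_lipschitz_mul hΩm hχlip hχB (hasCompactSupport_cutoff ρ)
  have hs2 : MemLp (fun x => (m x : ℂ) * (conjD t : Lp ℂ 2 (bdry Ω)) x) 2 (bdry Ω) :=
    (Lp.memLp _).lipschitz_mul hmlip hmB
  have hχ1 : ∀ᵐ x ∂(bdry Ω), hs2.toLp _ x = (cutoff ρ x : ℂ) * hs2.toLp _ x := by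
    filter_upwards [ae_restrict_mem isClosed_frontier.measurableSet] with x hx
    rw [cutoff_eq_one (mem_closedBall_zero_iff.1 (hfr hx)), Complex.ofReal_one, one_mul]
  have hws := (IsDirichletTrace.lipschitz_mul hφ.conj ht.conj hmlip hmB
    hs2.coeFn_toLp).lipschitz_mul b hχlip hχB hχ1
  have hpair : duality q (conjD t) = duality p ⟨hs2.toLp, _, _, hw, hws⟩ := by
    refine hq _ _ ?_
    filter_upwards [ae_restrict_mem isClosed_frontier.measurableSet, hs2.coeFn_toLp] with x hx h
    rw [hext x hx]
    exact h
  have hbd : Bornology.IsBounded (Function.support fun x : Space d =>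
      (cutoff ρ x : ℂ) * ((m x : ℂ) * star (φ x))) :=
    Metric.isBounded_closedBall.subset
      ((Function.support_mul_subset_left _ _).trans (support_cutoff_subset ρ))
  rw [hpair]
  exact hp _ _ _ hw hbd hws

/-- The flux through the boundary is controlled by the defect in the radiation condition on the
shell in which the cutoff varies. For bounded `Ω` and large `ρ` the right side vanishes. -/
theorem ofReal_im_duality_le {Ω : Set (Space d)} (hd : 1 ≤ d) (hΩ : IsOpen Ω) {μ : Space d → ℝ}
    {κ : Space d → ℂ} {κ₀ ρ₀ : ℝ} (hmed : IsAdmissibleMedium μ κ κ₀ ρ₀) {K : NNReal}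
    (hμ : LipschitzOnWith K μ Ω) {φ L : Space d → ℂ} {g : Space d → CVec d}
    {p q : dualTraceSpace Ω} {t : traceSpace Ω} (hφ : MemH1LapLoc Ω φ g L)
    (heq : IsWeakDiv Ω (fun x => (μ x : ℂ) • g x) (fun x => -(κ x ^ 2 * φ x)))
    (ht : IsDirichletTrace Ω φ g t) (hp : IsNeumannTrace Ω g L p)
    (hq : IsProduct (extendFrom Ω μ) p q) {C : NNReal}
    (hC : ∀ s, deriv Real.smoothTransition s ≤ C) {ρ : ℝ}
    (hfr : frontier Ω ⊆ Metric.closedBall 0 ρ)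
    (hone : ∀ x ∈ Ω, ‖x‖ ∈ Icc ρ (ρ + 1) → μ x = 1) :
    ENNReal.ofReal (duality q (conjD t)).im ≤ ENNReal.ofReal (C / (4 * κ₀)) *
      ∫⁻ x in Ω ∩ {x : Space d | ‖x‖ ∈ Icc ρ (ρ + 1)},
        ‖(∑ i, ((x i / ‖x‖ : ℝ) : ℂ) * g x i) - Complex.I * κ₀ * φ x‖ₑ ^ 2 := by
  have hΩm := hΩ.measurableSet
  obtain ⟨B, hB⟩ := hmed.bounded
  have hμB : ∀ x, μ x ≤ B := fun x => by
    linarith [le_abs_self (μ x), abs_nonneg (μ x)⁻¹, norm_nonneg (κ x), hB x]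
  have hκB : ∀ x, ‖κ x‖ ≤ B := fun x => by
    linarith [abs_nonneg (μ x), abs_nonneg (μ x)⁻¹, norm_nonneg (κ x), hB x]
  have hB0 : 0 ≤ B := (norm_nonneg _).trans (hκB 0)
  have hμ0B : ∀ x ∈ Ω, μ x ∈ Icc 0 B := fun x _ => ⟨(hmed.mu_pos x).le, hμB x⟩
  obtain ⟨m, hmlip, hmμ, hmB, hext⟩ := exists_lipschitz_extension hB0 hμ hμ0B
  -- the equation in non-divergence form
  have hf : MemL2Loc Ω (fun x => -(κ x ^ 2 * φ x)) := fun R => by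
    refine (hφ.memH1Loc.memL2Loc R).of_le_mul (c := B ^ 2)
      ((hmed.measurable_kappa.pow_const 2).aestronglyMeasurable.mul
        (hφ.memH1Loc.memL2Loc R).1).neg (Eventually.of_forall fun x => ?_)
    rw [norm_neg, norm_mul, norm_pow]
    exact mul_le_mul_of_nonneg_right (pow_le_pow_left₀ (norm_nonneg _) (hκB x) 2) (norm_nonneg _)
  have heq' : IsWeakDiv Ω (fun x => (m x : ℂ) • g x) (fun x => -(κ x ^ 2 * φ x)) := by
    intro ψ hψ
    rw [← heq ψ hψ]
    refine setIntegral_congr_fun hΩm fun x hx => ?_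
    dsimp only
    rw [hmμ x hx]
  have hstrong := ae_eq_of_isWeakDiv_lipschitz_smul hΩ hφ.memH1Loc.memL2Loc_grad
    hφ.memL2Loc_lap hf hφ.weakDiv hmlip hmB heq'
  rw [duality_conjD_eq hΩ hmlip hmB hext hφ.memH1Loc ht hp hq hfr]
  refine (ofReal_im_integral_le _).trans ?_
  have hS : MeasurableSet {x : Space d | ‖x‖ ∈ Icc ρ (ρ + 1)} :=
    measurable_norm measurableSet_Icc
  rw [← lintegral_const_mul' _ _ ENNReal.ofReal_ne_top, inter_comm,
    ← Measure.restrict_restrict hS, ← lintegral_indicator hS]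
  have : Nonempty (Fin d) := ⟨⟨0, hd⟩⟩
  have : Nontrivial (Space d) := inferInstance
  have hne : ∀ᵐ x ∂(volume.restrict Ω), x ≠ (0 : Space d) :=
    ae_restrict_of_ae (Measure.ae_ne volume 0)
  refine lintegral_mono_ae ?_
  filter_upwards [hstrong, hne, ae_restrict_mem hΩm] with x hx hx0 hxΩ
  set D := ∑ i, ((x i / ‖x‖ : ℝ) : ℂ) * g x i with hD
  set c := deriv Real.smoothTransition (ρ + 1 - ‖x‖) with hc
  have him : (0 : ℝ) ≤ (κ x ^ 2).im := by
    have : (κ x ^ 2).im = 2 * ((κ x).re * (κ x).im) := by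
      rw [sq, Complex.mul_im]; ring
    rw [this]
    exact mul_nonneg zero_le_two (mul_nonneg (hmed.kappa_re x) (hmed.kappa_im x))
  have hle := im_energy_density_le hx (dot_grad_cutoff ρ hx0 (g x)) (cutoff_nonneg ρ x) him
  rw [← hD, ← hc] at hle
  have h4κ : 0 < 4 * κ₀ := mul_pos (by norm_num) hmed.kappa₀_pos
  have hCκ : (0 : ℝ) ≤ C / (4 * κ₀) := div_nonneg C.2 h4κ.le
  by_cases hxS : x ∈ {x : Space d | ‖x‖ ∈ Icc ρ (ρ + 1)}
  · rw [indicator_of_mem hxS, ← ofReal_norm, ← ENNReal.ofReal_pow (norm_nonneg _),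
      ← ENNReal.ofReal_mul hCκ]
    refine ENNReal.ofReal_le_ofReal (hle.trans ?_)
    rw [hmμ x hxΩ, hone x hxΩ hxS, one_mul]
    have h1 := im_flux_le hmed.kappa₀_pos (φ x) D
    have h2 : 0 ≤ ‖D - Complex.I * κ₀ * φ x‖ ^ 2 / (4 * κ₀) :=
      div_nonneg (sq_nonneg _) h4κ.le
    calc c * -(star (φ x) * D).im ≤ c * (‖D - Complex.I * κ₀ * φ x‖ ^ 2 / (4 * κ₀)) :=
          mul_le_mul_of_nonneg_left h1 (deriv_smoothTransition_nonneg _)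
      _ ≤ C * (‖D - Complex.I * κ₀ * φ x‖ ^ 2 / (4 * κ₀)) :=
          mul_le_mul_of_nonneg_right (hC _) h2
      _ = _ := by ring
  · have hc0 : c = 0 := deriv_smoothTransition_eq_zero fun h => hxS
      ⟨by linarith [h.2], by linarith [h.1]⟩
    rw [hc0, mul_zero, zero_mul] at hle
    rw [ENNReal.ofReal_of_nonpos hle]
    exact zero_le

/-- Every Cauchy datum has nonpositive flux. -/
theorem im_duality_nonpos (hd : 1 ≤ d) {J : ℕ} {Ω : Fin (J + 1) → Set (Space d)}
    (hΩ : IsSubdomainPartition Ω) {μ : Space d → ℝ} {κ : Space d → ℂ} {κ₀ ρ₀ : ℝ}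
    (hmed : IsAdmissibleMedium μ κ κ₀ ρ₀) {j : Fin (J + 1)} {K : NNReal}
    (hμ : LipschitzOnWith K μ (Ω j)) {u : TracePair (Ω j)} (hu : u ∈ cauchyData Ω μ κ κ₀ j) :
    (duality u.2 (conjD u.1)).im ≤ 0 := by
  obtain ⟨φ, g, L, p, hφ, heq, hout, ht, hp, hq⟩ := hu
  obtain ⟨C, hC⟩ := exists_deriv_smoothTransition_le
  rw [← ENNReal.ofReal_eq_zero, ← nonpos_iff_eq_zero]
  obtain ⟨R, hR⟩ := (hΩ.isBounded_frontier j).subset_closedBall 0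
  by_cases hj : j = 0
  · have hlim := ENNReal.Tendsto.const_mul (a := ENNReal.ofReal (C / (4 * κ₀)))
      ((hout hj).tendsto_shell hd) (Or.inr ENNReal.ofReal_ne_top)
    rw [mul_zero] at hlim
    refine ge_of_tendsto hlim ?_
    filter_upwards [eventually_ge_atTop R, eventually_gt_atTop ρ₀] with ρ hρR hρ
    refine (ofReal_im_duality_le hd (hΩ.lipschitz j).1 hmed hμ hφ heq ht hp hq hC
      (hR.trans (Metric.closedBall_subset_closedBall hρR)) fun x _ hx =>
        hmed.mu_far x (hρ.trans_le hx.1)).trans ?_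
    gcongr
    exact inter_subset_right
  · obtain ⟨R', hR'⟩ := (hΩ.bounded j hj).subset_ball 0
    have hin : ∀ x ∈ Ω j, ‖x‖ ∉ Icc (max R R') (max R R' + 1) := fun x hx h =>
      absurd (mem_ball_zero_iff.1 (hR' hx)) (not_lt.2 ((le_max_right R R').trans h.1))
    refine (ofReal_im_duality_le hd (hΩ.lipschitz j).1 hmed hμ hφ heq ht hp hq hC
      (hR.trans (Metric.closedBall_subset_closedBall (le_max_left R R'))) fun x hx h =>
        absurd h (hin x hx)).trans ?_
    have hempty : Ω j ∩ {x : Space d | ‖x‖ ∈ Icc (max R R') (max R R' + 1)} = ∅ :=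
      eq_empty_of_forall_notMem fun x hx => hin x hx.1 hx.2
    rw [hempty]
    simp

lemma I_mul_skew_conjPair {Ω : Set (Space d)} (u : TracePair Ω) :
    Complex.I * skew u (conjPair u) = ((2 * (duality u.2 (conjD u.1)).im : ℝ) : ℂ) := by
  have h : skew u (conjPair u) = star (duality u.2 (conjD u.1)) - duality u.2 (conjD u.1) := rfl
  rw [h]
  apply Complex.ext <;> simp
  ring

end Helmholtz
end

theorem mainTheorem6 (d : ℕ) (hd : 1 ≤ d) (hd' : d ≤ 3) (J : ℕ)
    (Ω : Fin (J + 1) → Set (Helmholtz.Space d)) (hΩ : Helmholtz.IsSubdomainPartition Ω)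
    (μ : Helmholtz.Space d → ℝ) (κ : Helmholtz.Space d → ℂ) (κ₀ ρ₀ : ℝ)
    (hmed : Helmholtz.IsAdmissibleMedium μ κ κ₀ ρ₀)
    (hμ : ∀ j, ∃ K : NNReal, LipschitzOnWith K μ (Ω j)) :
    (∀ j, ∀ u ∈ Helmholtz.cauchyData Ω μ κ κ₀ j,
      Complex.I * Helmholtz.skew u (Helmholtz.conjPair u) ≤ 0) ∧
    (∀ u ∈ Helmholtz.multiCauchyData Ω μ κ κ₀,
      Complex.I * Helmholtz.multiSkew u (Helmholtz.conjMulti u) ≤ 0) := by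
  have hone : ∀ j, ∀ u ∈ Helmholtz.cauchyData Ω μ κ κ₀ j,
      Complex.I * Helmholtz.skew u (Helmholtz.conjPair u) ≤ 0 := by
    intro j u hu
    obtain ⟨K, hK⟩ := hμ j
    have := Helmholtz.im_duality_nonpos hd hΩ hmed hK hu
    rw [Helmholtz.I_mul_skew_conjPair]
    exact_mod_cast (by linarith : 2 * (Helmholtz.duality u.2 (Helmholtz.conjD u.1)).im ≤ 0)
  refine ⟨hone, fun u hu => ?_⟩
  rw [Helmholtz.multiSkew, Finset.mul_sum]
  exact Finset.sum_nonpos fun j _ => hone j (u j) (hu j)
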